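/- Model. Jobs have states in a finite set $S$ that forms a rooted tree with levels $S_0,\dots,S_{L-1}$ and root $r_0$, $S_0=\{r_0\}$; every state $i\in S_\ell$ with $\ell>0$ has a unique parent in $S_{\ell-1}$. A job in state $i$ moves to a child $k$ of $i$ with probability $P(i,k)>0$ (and $P(i,k)=0$ if $k$ is not a child of $i$), where $\sum_k P(i,k)\le 1$; with the remaining probability it abandons the system. Let $c_i>0$ be the holding cost of state $i$, $c_{\max}=\max_i c_i$, $\theta=\min_{i}\bigl(1-\sum_{k\text{ child of }i}P(i,k)\bigr)$, $p(r_0)=1$, $p(i)=P(\text{parent of }i,i)$ for $i\ne r_0$, and let $\pi(i)$ be the product of $p(k)$ over all $k$ on the path from $r_0$ to $i$ (both included). Write $\mathrm{sub}(i)$ for the subtree of $i$ (including $i$), and $\mathrm{sub}(X)=\bigcup_{i\in X}\mathrm{sub}(i)$. Let $N\ge 1$, $\lambda\in(0,1)$, $\mu\in(0,1]$. The queue is empty before period $1$. In each period $t\ge1$: $R(t)\sim\mathrm{Bin}(N,\mu)$ servers are available; the algorithm selects a set of at most $R(t)$ waiting jobs, which leave at no cost; each remaining job in state $i$ incurs cost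 $c_i$, and then moves according to $P$ or abandons; finally $A(t)\sim\mathrm{Bin}(N,\lambda)$ new jobs arrive in state $r_0$. Server numbers, arrivals and job transitions are independent. The long-run average holding cost is $\limsup_{T\to\infty}\frac1T$ times the expected total holding cost of periods $1,\dots,T$. For an ordering $o=(o_1,\dots,o_{|S|})$ of $S$ (highest priority first), the priority policy $\mathrm{Prio}(o)$ serves, with $Q_i(t)$ the number of waiting jobs in state $i$, exactly $R_i(t)=\min\bigl(Q_i(t),\,(R(t)-\sum_{h<o^{-1}(i)}Q_{o_h}(t))^+\bigr)$ jobs in state $i$ (ties within a state are broken arbitrarily, without knowledge of the future). Let $C(N,\mathrm{Prio}(o))$ be its long-run average holding cost. Water-filling equilibrium. For $X\subseteq S$ let $\mathrm{Top}(X)$ be the unique set with $\mathrm{Top}(X)\subseteq X\subseteq\mathrm{sub}(\mathrm{Top}(X))$ and $k\notin\mathrm{sub}(i)$ for distinct $i,k\in\mathrm{Top}(X)$. Let $m\in\{0,\dots,|S|\}$ be maximal with $\sum_{i\in\mathrm{Top}(B)}\lambda\pi(i)\le\mu$, where $B=\{o_1,\dots,o_m\}$. If this inequality is strict and $m<|S|$,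 let $p^\ast=o_{m+1}$ be the partially-served state, $\kappa=1-\sum_{i\in\mathrm{Top}(B)\cap\mathrm{sub}(p^\ast)}\pi(i)/\pi(p^\ast)$ and $\nu^\ast=\bigl(\mu-\lambda\sum_{i\in\mathrm{Top}(B)}\pi(i)\bigr)/\kappa$; otherwise there is no partially-served state. Put $a_i=\lambda\pi(i)-\nu^\ast\pi(i)/\pi(p^\ast)$ if there is a partially-served state and $i\in\mathrm{sub}(p^\ast)\setminus\{p^\ast\}$, and $a_i=\lambda\pi(i)$ otherwise. The equilibrium $(q^o,\nu^o)$ is given by: $q^o_i=\nu^o_i=a_i$ for $i\in\mathrm{Top}(B)$; $q^o_i=\nu^o_i=0$ for $i\in\mathrm{sub}(B)\setminus\mathrm{Top}(B)$; for all other $i$, $q^o_i=a_i$, and $\nu^o_i=\nu^\ast$ if $i=p^\ast$, $\nu^o_i=0$ if not. Lemma. If $\theta>0$, then for every ordering $o$ and every $N\ge1$, $$C(N,\mathrm{Prio}(o))\;\le\;N\sum_{i\in S}c_i\,(q^o_i-\nu^o_i)\;+\;c_{\max}\,U(L,\theta,\ln N)\,\sqrt N,\qquad U(L,\theta,\ln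 N)=1610\,\theta^{-2}L^{1.5}\bigl(\ln(55NL)\bigr)^2 .$$ -/

import Mathlib

open Filter
open scoped ENNReal

noncomputable section

namespace PrioQueue

/-! ### The tree-shaped Markov chain of job states -/

/-- A Markov chain on a finite state space `S` that is a rooted tree with levels `0, …, L - 1`.
From state `i` a job moves to a child `k` of `i` with probability `P i k`, and with the remaining
probability to the empty state (it abandons). `parent root = none`. -/
structure TreeChain (S : Type*) [Fintype S] (L : ℕ) where
  level : S → Fin L
  root : S
  parent : S → Option S
  P : S → S → ℝ
  cost : S → ℝ
  cost_pos : ∀ i, 0 < cost i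
  level_root : (level root : ℕ) = 0
  parent_eq_none : ∀ i, parent i = none ↔ i = root
  level_parent : ∀ i a, parent i = some a → (level i : ℕ) = level a + 1
  P_pos : ∀ i a, parent i = some a → 0 < P a i
  P_eq_zero : ∀ i k, parent i ≠ some k → P k i = 0
  P_sum_le_one : ∀ i, ∑ k, P i k ≤ 1

namespace TreeChain

variable {S : Type*} [Fintype S] {L : ℕ} (M : TreeChain S L)

open Classical in
/-- The children of `i`. -/
def child (i : S) : Finset S := Finset.univ.filter fun k => M.parent k = some i

/-- The probability that a job in state `i` abandons at its next transition. -/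
def abandon (i : S) : ℝ := 1 - ∑ k ∈ M.child i, M.P i k

/-- The minimum abandonment probability. -/
def theta : ℝ := Finset.univ.inf' ⟨M.root, Finset.mem_univ _⟩ M.abandon

/-- The maximum holding cost of a state. -/
def cmax : ℝ := Finset.univ.sup' ⟨M.root, Finset.mem_univ _⟩ M.cost

/-- `M.IsAnc k i`: the state `k` lies on the path from the root to `i` (both ends included). -/
def IsAnc (k i : S) : Prop := Relation.ReflTransGen (fun a b => M.parent b = some a) k i

open Classical in
/-- The ancestors of `i`, including `i`. -/
def anc (i : S) : Finset S := Finset.univ.filter fun k => M.IsAnc k i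

open Classical in
/-- The subtree of `i`, including `i`. -/
def sub (i : S) : Finset S := Finset.univ.filter fun k => i ∈ M.anc k

open Classical in
/-- The subtree of a set of states. -/
def subSet (X : Finset S) : Finset S := X.biUnion M.sub

/-- The transition probability `p i` into `i` from its parent, with `p root = 1`. -/
def p (i : S) : ℝ :=
  match M.parent i with
  | none => 1
  | some a => M.P a i

/-- The probability that a job passes through state `i` if it is never served. -/
def pi (i : S) : ℝ := ∏ k ∈ M.anc i, M.p k

/-- `T` is a top set of `X`. -/
def IsTop (T X : Finset S) : Prop :=
  T ⊆ X ∧ X ⊆ M.subSet T ∧ ∀ i ∈ T, ∀ k ∈ T, i ≠ k → k ∉ M.sub i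

open Classical in
/-- The top set of `X`: the states of `X` none of whose other ancestors is in `X`. -/
def top (X : Finset S) : Finset S :=
  X.filter fun i => ∀ k ∈ X, M.IsAnc k i → k = i

theorem mem_sub {i k : S} : k ∈ M.sub i ↔ M.IsAnc i k := by
  classical
  simp [sub, anc]

theorem level_le_of_isAnc {k i : S} (h : M.IsAnc k i) :
    k = i ∨ (M.level k : ℕ) < M.level i := by
  induction h with
  | refl => exact Or.inl rfl
  | tail _ hbc ih =>
    have := M.level_parent _ _ hbc
    rcases ih with rfl | ih
    · right; omega
    · right; omega

/-- `M.top X` is the unique top set of `X`. -/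
theorem isTop_iff (T X : Finset S) : M.IsTop T X ↔ T = M.top X := by
  classical
  have key : ∀ n : ℕ, ∀ i ∈ X, (M.level i : ℕ) ≤ n → ∃ k ∈ M.top X, M.IsAnc k i := by
    intro n
    induction n with
    | zero =>
      intro i hi hn
      refine ⟨i, ?_, Relation.ReflTransGen.refl⟩
      simp only [top, Finset.mem_filter]
      refine ⟨hi, fun k _ hki => ?_⟩
      rcases M.level_le_of_isAnc hki with h | h
      · exact h
      · omega
    | succ n ih =>
      intro i hi hn
      by_cases h : ∀ k ∈ X, M.IsAnc k i → k = i
      · exact ⟨i, by simp only [top, Finset.mem_filter]; exact ⟨hi, h⟩,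
          Relation.ReflTransGen.refl⟩
      · push Not at h
        obtain ⟨k, hk, hki, hne⟩ := h
        rcases M.level_le_of_isAnc hki with h | h
        · exact absurd h hne
        · obtain ⟨k', hk', h'⟩ := ih k hk (by omega)
          exact ⟨k', hk', h'.trans hki⟩
  constructor
  · rintro ⟨h1, h2, h3⟩
    have h2' : ∀ i ∈ X, ∃ k ∈ T, M.IsAnc k i := by
      intro i hi
      have := h2 hi
      simpa [subSet, mem_sub] using this
    have anti : ∀ a b : S, M.IsAnc a b → M.IsAnc b a → a = b := by
      intro a b hab hba
      rcases M.level_le_of_isAnc hab with h | h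
      · exact h
      · rcases M.level_le_of_isAnc hba with h' | h'
        · exact h'.symm
        · omega
    ext i
    simp only [top, Finset.mem_filter]
    constructor
    · intro hi
      refine ⟨h1 hi, fun k hk hki => ?_⟩
      obtain ⟨t, ht, htk⟩ := h2' k hk
      by_contra hne
      by_cases hti : t = i
      · subst hti
        exact hne (anti _ _ hki htk)
      · exact h3 t ht i hi hti (M.mem_sub.2 (htk.trans hki))
    · rintro ⟨hi, h⟩
      obtain ⟨t, ht, hti⟩ := h2' i hi
      rw [← h t (h1 ht) hti]
      exact ht
  · rintro rfl
    refine ⟨Finset.filter_subset _ _, ?_, ?_⟩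
    · intro i hi
      obtain ⟨k, hk, hki⟩ := key _ i hi le_rfl
      simp only [subSet, Finset.mem_biUnion, mem_sub]
      exact ⟨k, hk, hki⟩
    · intro i hi k hk hne hs
      simp only [top, Finset.mem_filter] at hi hk
      exact hne (hk.2 i hi.1 (M.mem_sub.1 hs))

theorem P_nonneg (i k : S) : 0 ≤ M.P i k := by
  by_cases h : M.parent k = some i
  · exact (M.P_pos _ _ h).le
  · exact (M.P_eq_zero _ _ h).ge

theorem sum_P (i : S) : ∑ k, M.P i k = ∑ k ∈ M.child i, M.P i k := by
  classical
  symm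
  apply Finset.sum_subset (Finset.subset_univ _)
  intro k _ hk
  exact M.P_eq_zero _ _ (by simpa [child] using hk)

/-- The law of the next state of a job in state `i`; `none` is the empty state. -/
def step (i : S) : PMF (Option S) :=
  PMF.ofFintype
    (fun o => match o with
      | none => ENNReal.ofReal (M.abandon i)
      | some k => ENNReal.ofReal (M.P i k)) (by
    rw [Fintype.sum_option, ← ENNReal.ofReal_sum_of_nonneg (fun k _ => M.P_nonneg i k),
      ← ENNReal.ofReal_add, abandon, ← M.sum_P]
    · simp
    · rw [abandon, ← M.sum_P]
      linarith [M.P_sum_le_one i]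
    · exact Finset.sum_nonneg fun k _ => M.P_nonneg i k)

/-! ### The fluid equilibrium of a priority ordering -/

section Fluid

variable (lam mu : ℝ) (o : Fin (Fintype.card S) ≃ S)

open Classical in
/-- The set of the `m` states of highest priority. -/
def first (o : Fin (Fintype.card S) ≃ S) (m : ℕ) : Finset S :=
  Finset.univ.filter fun i => (o.symm i : ℕ) < m

/-- The service rate that is needed to serve the top set of the first `m` states. -/
def load (m : ℕ) : ℝ := ∑ i ∈ M.top (first o m), lam * M.pi i

open Classical in
/-- The maximum position `m ∈ {0, …, |S|}` such that the service rate `mu` suffices to serve the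
top set of the first `m` states. -/
def cut : ℕ := Nat.findGreatest (fun m => M.load lam o m ≤ mu) (Fintype.card S)

/-- The states `o_1, …, o_m` with `m = cut`. -/
def served : Finset S := first o (M.cut lam mu o)

open Classical in
/-- The partially-served state, if there is one. -/
def partialNode : Option S :=
  if h : M.cut lam mu o < Fintype.card S ∧ M.load lam o (M.cut lam mu o) < mu then
    some (o ⟨M.cut lam mu o, h.1⟩)
  else none

open Classical in
/-- The degeneracy parameter, if `r` is the partially-served state. -/
def kappa (r : S) : ℝ :=
  1 - ∑ i ∈ M.top (M.served lam mu o) ∩ M.sub r, M.pi i / M.pi r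

/-- The service rate given to the partially-served state `r`. -/
def nuPartial (r : S) : ℝ :=
  (mu - lam * ∑ i ∈ M.top (M.served lam mu o), M.pi i) / M.kappa lam mu o r

open Classical in
/-- The rate of jobs in state `i`, if no state other than the partially-served state is served. -/
def inflow (i : S) : ℝ :=
  match M.partialNode lam mu o with
  | none => lam * M.pi i
  | some r =>
    if i ∈ M.sub r ∧ i ≠ r then
      lam * M.pi i - M.nuPartial lam mu o r * M.pi i / M.pi r
    else lam * M.pi i

open Classical in
/-- The equilibrium queue lengths. The branches are: blocked states (fully or partially),
empty states, and all other states (un-reduced, partially-served, partially-reduced). -/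
def qEq (i : S) : ℝ :=
  if i ∈ M.top (M.served lam mu o) then M.inflow lam mu o i
  else if i ∈ M.subSet (M.served lam mu o) then 0
  else M.inflow lam mu o i

open Classical in
/-- The equilibrium service rates. The branches are: blocked states (fully or partially),
empty states, the partially-served state, and un-reduced or partially-reduced states. -/
def nuEq (i : S) : ℝ :=
  if i ∈ M.top (M.served lam mu o) then M.inflow lam mu o i
  else if i ∈ M.subSet (M.served lam mu o) then 0
  else if M.partialNode lam mu o = some i then M.nuPartial lam mu o i
  else 0

/-- The fluid cost of the equilibrium. -/
def fluidCost : ℝ := ∑ i, M.cost i * (M.qEq lam mu o i - M.nuEq lam mu o i)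

end Fluid

end TreeChain

/-! ### The queueing system -/

/-- A waiting job: it is the job with number `index` among those that arrived in period `period`,
and `state` is its current state. -/
structure Job (S : Type*) where
  period : ℕ
  index : ℕ
  state : S

/-- The data of one period `t`: the queue of waiting jobs, the number of available servers and the
set of jobs selected for service. -/
structure Period (S : Type*) where
  queue : Finset (Job S)
  servers : ℕ
  served : Finset (Job S)

/-- A (possibly randomized) scheduling algorithm: from the history of the earlier periods (the most
recent one first), the current queue and the current number of servers, it draws the set of jobs
to be served. -/
abbrev Policy (S : Type*) := List (Period S) → Finset (Job S) → ℕ → PMF (Finset (Job S))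

/-- The selected jobs are waiting jobs, and no more than there are servers. -/
def Policy.Feasible {S : Type*} (A : Policy S) : Prop :=
  ∀ h Q R, ∀ X ∈ (A h Q R).support, X ⊆ Q ∧ X.card ≤ R

open Classical in
/-- The number of jobs in state `i` in a set of jobs. -/
def countState {S : Type*} (Q : Finset (Job S)) (i : S) : ℕ :=
  (Q.filter fun j => j.state = i).card

/-- `A` is a priority algorithm for the ordering `o`: the number of served jobs in state `i` is the
minimum of the number of waiting jobs in state `i` and of the number of servers left after all jobs
in states of higher priority (truncated subtraction: the positive part). Ties between jobs in the
same state may be broken in any way. -/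
def Policy.IsPrio {S : Type*} [Fintype S] (A : Policy S) (o : Fin (Fintype.card S) ≃ S) : Prop :=
  A.Feasible ∧ ∀ h Q R, ∀ X ∈ (A h Q R).support, ∀ i : S,
    countState X i =
      min (countState Q i) (R - ∑ k ∈ Finset.Iio (o.symm i), countState Q (o k))

/-- The binomial distribution on `ℕ`. -/
def bin (N : ℕ) (x : unitInterval) : PMF ℕ := (ProbabilityTheory.binomial N x).toPMF

section System

variable {S : Type*} [Fintype S] {L : ℕ} (M : TreeChain S L)

open Classical in
/-- The joint law of the next states of the jobs in `Z`: they are independent, and each job moves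
according to the transition kernel. -/
def moves (Z : Finset (Job S)) : PMF (Z → Option S) :=
  PMF.ofFintype (fun f => ∏ j : Z, M.step j.1.state (f j)) (by
    rw [← Fintype.piFinset_univ, ← Finset.prod_univ_sum]
    apply Finset.prod_eq_one
    intro j _
    rw [← tsum_fintype (L := .unconditional _)]
    exact (M.step j.1.state).tsum_coe)

open Classical in
/-- The jobs waiting after the remaining jobs `Z` have moved according to `f` and `a` new jobs
have arrived in period `t`. -/
def nextQueue (t : ℕ) (Z : Finset (Job S)) (f : Z → Option S) (a : ℕ) : Finset (Job S) :=
  (Finset.univ.biUnion fun j : Z =>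
    match f j with
    | none => ∅
    | some k => {(⟨j.1.period, j.1.index, k⟩ : Job S)}) ∪
  (Finset.range a).image fun n => (⟨t, n, M.root⟩ : Job S)

open Classical in
/-- The jobs that remain after service. -/
def Period.remaining (x : Period S) : Finset (Job S) := x.queue \ x.served

/-- The law of the number of servers and of the served jobs, given the history and the queue. -/
def serve (N : ℕ) (mu : unitInterval) (A : Policy S) (h : List (Period S)) (Q : Finset (Job S)) :
    PMF (Period S) :=
  (bin N mu).bind fun R => (A h Q R).map fun X => ⟨Q, R, X⟩

/-- The law of the next period, given the history of all earlier periods (the most recent one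
first). In the first period there is no waiting job. After period `t` the remaining jobs move, and
`Bin(N, lam)` new jobs arrive in the root state, independently of each other. -/
def nextPeriod (N : ℕ) (lam mu : unitInterval) (A : Policy S) :
    List (Period S) → PMF (Period S)
  | [] => serve N mu A [] ∅
  | x :: h => (moves M x.remaining).bind fun f => (bin N lam).bind fun a =>
      serve N mu A (x :: h) (nextQueue M (h.length + 1) x.remaining f a)

/-- The law of the history of the first `T` periods (the most recent one first). -/
def historyLaw (N : ℕ) (lam mu : unitInterval) (A : Policy S) : ℕ → PMF (List (Period S))
  | 0 => PMF.pure []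
  | T + 1 => (historyLaw N lam mu A T).bind fun h =>
      (nextPeriod M N lam mu A h).map fun x => x :: h

/-- The holding cost incurred in a period. -/
def periodCost (x : Period S) : ℝ≥0∞ := ∑ j ∈ x.remaining, ENNReal.ofReal (M.cost j.state)

/-- The expected total holding cost of the first `T` periods. -/
def expectedCost (N : ℕ) (lam mu : unitInterval) (A : Policy S) (T : ℕ) : ℝ≥0∞ :=
  ∑' h : List (Period S), historyLaw M N lam mu A T h * (h.map (periodCost M)).sum

/-- The long-run average holding cost of the algorithm `A` in the system of size `N`. -/
def longRunCost (N : ℕ) (lam mu : unitInterval) (A : Policy S) : ℝ≥0∞ :=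
  limsup (fun T : ℕ => expectedCost M N lam mu A T / (T : ℝ≥0∞)) atTop

end System

/-- The factor `U(L, θ, ln N)`. -/
def U (L : ℕ) (theta : ℝ) (N : ℕ) : ℝ :=
  1610 * (theta ^ 2)⁻¹ * (L : ℝ) ^ (3 / 2 : ℝ) * Real.log (55 * N * L) ^ 2

end PrioQueue

end

open Filter
open scoped ENNReal

noncomputable section

namespace PrioQueue

namespace TreeChain

variable {S : Type*} [Fintype S] {L : ℕ} (M : TreeChain S L)

theorem isAnc_refl (i : S) : M.IsAnc i i := Relation.ReflTransGen.refl

theorem isAnc_antisymm {a b : S} (hab : M.IsAnc a b) (hba : M.IsAnc b a) : a = b := by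
  rcases M.level_le_of_isAnc hab with h | h
  · exact h
  · rcases M.level_le_of_isAnc hba with h' | h'
    · exact h'.symm
    · omega

theorem mem_anc {i k : S} : k ∈ M.anc i ↔ M.IsAnc k i := by
  classical
  simp [anc]

theorem mem_child {i k : S} : k ∈ M.child i ↔ M.parent k = some i := by
  classical
  simp [child]

theorem mem_subSet {X : Finset S} {k : S} : k ∈ M.subSet X ↔ ∃ i ∈ X, M.IsAnc i k := by
  classical
  simp [subSet, mem_sub]

theorem mem_top {X : Finset S} {i : S} :
    i ∈ M.top X ↔ i ∈ X ∧ ∀ k ∈ X, M.IsAnc k i → k = i := by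
  classical
  simp [top]

theorem mem_first {o : Fin (Fintype.card S) ≃ S} {m : ℕ} {i : S} :
    i ∈ first o m ↔ (o.symm i : ℕ) < m := by
  classical
  simp [first]

theorem isAnc_of_parent {i k : S} (h : M.parent k = some i) : M.IsAnc i k :=
  Relation.ReflTransGen.single h

/-- A proper ancestor of `k` is an ancestor of the parent of `k`. -/
theorem isAnc_iff_of_parent {a i k : S} (h : M.parent k = some i) :
    M.IsAnc a k ↔ a = k ∨ M.IsAnc a i := by
  constructor
  · intro hak
    rcases Relation.ReflTransGen.cases_tail hak with h' | ⟨c, hac, hck⟩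
    · exact Or.inl h'.symm
    · rw [h] at hck
      cases hck
      exact Or.inr hac
  · rintro (rfl | h')
    · exact M.isAnc_refl _
    · exact h'.tail h

theorem isAnc_root_iff {a : S} : M.IsAnc a M.root ↔ a = M.root := by
  constructor
  · intro h
    rcases Relation.ReflTransGen.cases_tail h with h' | ⟨c, _, hc⟩
    · exact h'.symm
    · rw [(M.parent_eq_none _).2 rfl] at hc
      cases hc
  · rintro rfl
    exact M.isAnc_refl _

/-- The states on a path are comparable. -/
theorem isAnc_total {a b i : S} (ha : M.IsAnc a i) (hb : M.IsAnc b i) :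
    M.IsAnc a b ∨ M.IsAnc b a := by
  induction ha with
  | refl => exact Or.inr hb
  | tail hac hcd ih =>
    rcases (M.isAnc_iff_of_parent hcd).1 hb with rfl | hb
    · exact Or.inl (hac.tail hcd)
    · exact ih hb

theorem not_isAnc_of_parent {i k : S} (h : M.parent k = some i) : ¬ M.IsAnc k i := fun hk => by
  have := M.level_parent _ _ h
  have h2 := M.isAnc_antisymm hk (M.isAnc_of_parent h)
  subst h2
  omega

/-- A path leaves its starting point through a child. -/
theorem isAnc_iff_child {i x : S} :
    M.IsAnc i x ↔ x = i ∨ ∃ k, M.parent k = some i ∧ M.IsAnc k x := by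
  constructor
  · intro h
    rcases Relation.ReflTransGen.cases_head h with h' | ⟨c, hc, hcx⟩
    · exact Or.inl h'.symm
    · exact Or.inr ⟨c, hc, hcx⟩
  · rintro (rfl | ⟨k, hk, hkx⟩)
    · exact M.isAnc_refl _
    · exact (M.isAnc_of_parent hk).trans hkx

theorem parent_induction {C : S → Prop} (root : C M.root)
    (child : ∀ i k, M.parent k = some i → C i → C k) (i : S) : C i := by
  suffices H : ∀ n : ℕ, ∀ i, (M.level i : ℕ) = n → C i from H _ i rfl
  intro n
  induction n with
  | zero =>
    intro i hi
    cases h : M.parent i with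
    | none => rw [(M.parent_eq_none i).1 h]; exact root
    | some a => have := M.level_parent _ _ h; omega
  | succ n ih =>
    intro i hi
    cases h : M.parent i with
    | none => rw [(M.parent_eq_none i).1 h]; exact root
    | some a =>
      have := M.level_parent _ _ h
      exact child a i h (ih a (by omega))

theorem child_induction {C : S → Prop}
    (step : ∀ i, (∀ k, M.parent k = some i → C k) → C i) (i : S) : C i := by
  suffices H : ∀ n : ℕ, ∀ i, L - (M.level i : ℕ) = n → C i from H _ i rfl
  intro n
  induction n using Nat.strong_induction_on with
  | _ n ih =>
    intro i hi
    refine step i fun k hk => ih _ ?_ k rfl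
    have := M.level_parent _ _ hk
    have := (M.level k).2
    omega

theorem isAnc_root (i : S) : M.IsAnc M.root i :=
  M.parent_induction (C := M.IsAnc M.root) (M.isAnc_refl _) (fun _ _ h hi => hi.tail h) i

/-- A sum over a subtree splits into the subtrees of the children. -/
theorem sum_sub (i : S) (φ : S → ℝ) :
    ∑ x ∈ M.sub i, φ x = φ i + ∑ k ∈ M.child i, ∑ x ∈ M.sub k, φ x := by
  classical
  have h : M.sub i = insert i ((M.child i).biUnion M.sub) := by
    ext x
    simp only [mem_sub, Finset.mem_insert, Finset.mem_biUnion, mem_child]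
    exact M.isAnc_iff_child
  rw [h, Finset.sum_insert, Finset.sum_biUnion]
  · intro a ha b hb hab
    refine Finset.disjoint_left.2 fun x hxa hxb => hab ?_
    have ha : M.parent a = some i := by simpa [mem_child] using ha
    have hb : M.parent b = some i := by simpa [mem_child] using hb
    have hl := M.level_parent _ _ ha
    have hl' := M.level_parent _ _ hb
    rcases M.isAnc_total (M.mem_sub.1 hxa) (M.mem_sub.1 hxb) with h | h <;>
      rcases M.level_le_of_isAnc h with h | h
    · exact h
    · omega
    · exact h.symm
    · omega
  · simp only [Finset.mem_biUnion, mem_child, mem_sub, not_exists, not_and]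
    exact fun k hk => M.not_isAnc_of_parent hk

theorem sub_root : M.sub M.root = Finset.univ := by
  ext i
  simp [mem_sub, M.isAnc_root]

/-! ### Path probabilities -/

theorem pi_root : M.pi M.root = 1 := by
  classical
  have h : M.anc M.root = {M.root} := by
    ext i
    simp [mem_anc, isAnc_root_iff]
  have : M.parent M.root = none := (M.parent_eq_none _).2 rfl
  simp [pi, h, p, this]

theorem pi_child {i k : S} (h : M.parent k = some i) : M.pi k = M.pi i * M.P i k := by
  classical
  have h' : M.anc k = insert k (M.anc i) := by
    ext a
    simp [mem_anc, M.isAnc_iff_of_parent h]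
  rw [pi, h', Finset.prod_insert, mul_comm, pi]
  · simp [p, h]
  · rw [mem_anc]
    exact M.not_isAnc_of_parent h

theorem pi_pos (i : S) : 0 < M.pi i := by
  refine M.parent_induction (C := fun i => 0 < M.pi i) ?_ (fun i k h hi => ?_) i
  · simp [pi_root]
  · rw [M.pi_child h]
    exact mul_pos hi (M.P_pos _ _ h)

theorem P_le_one (i k : S) : M.P i k ≤ 1 :=
  (Finset.single_le_sum (f := M.P i) (fun k _ => M.P_nonneg i k) (Finset.mem_univ k)).trans
    (M.P_sum_le_one i)

theorem pi_le_one (i : S) : M.pi i ≤ 1 := by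
  refine M.parent_induction (C := fun i => M.pi i ≤ 1) ?_ (fun i k h hi => ?_) i
  · simp [pi_root]
  · rw [M.pi_child h]
    exact mul_le_one₀ hi (M.P_nonneg _ _) (M.P_le_one _ _)

theorem theta_le (i : S) : M.theta ≤ M.abandon i := Finset.inf'_le _ (Finset.mem_univ i)

theorem cost_le_cmax (i : S) : M.cost i ≤ M.cmax := Finset.le_sup' M.cost (Finset.mem_univ i)

theorem theta_le_one : M.theta ≤ 1 :=
  (M.theta_le M.root).trans
    (sub_le_self _ (Finset.sum_nonneg fun k _ => M.P_nonneg _ k))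

theorem sum_child_P_le (i : S) : ∑ k ∈ M.child i, M.P i k ≤ 1 - M.theta := by
  have := M.theta_le i
  rw [abandon] at this
  linarith

theorem sum_child_pi_le (i : S) :
    ∑ k ∈ M.child i, M.pi k ≤ M.pi i * (1 - M.theta) := by
  calc ∑ k ∈ M.child i, M.pi k = ∑ k ∈ M.child i, M.pi i * M.P i k :=
        Finset.sum_congr rfl fun k hk => M.pi_child (M.mem_child.1 hk)
    _ ≤ _ := by
        rw [← Finset.mul_sum]
        exact mul_le_mul_of_nonneg_left (M.sum_child_P_le i) (M.pi_pos i).le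

theorem theta_mul_sum_sub_pi_le (i : S) : M.theta * ∑ x ∈ M.sub i, M.pi x ≤ M.pi i := by
  refine M.child_induction (C := fun i => M.theta * ∑ x ∈ M.sub i, M.pi x ≤ M.pi i)
    (fun i ih => ?_) i
  rw [M.sum_sub, mul_add, Finset.mul_sum]
  have := Finset.sum_le_sum fun k hk => ih k (M.mem_child.1 hk)
  have := M.sum_child_pi_le i
  linarith

/-- The path probabilities of an antichain below `i` sum to at most that of `i`. -/
theorem sum_inter_sub_pi_le [DecidableEq S] {X : Finset S}
    (hX : ∀ i ∈ X, ∀ k ∈ X, M.IsAnc i k → i = k) (hθ : 0 ≤ M.theta) (i : S) :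
    ∑ x ∈ X ∩ M.sub i, M.pi x ≤ M.pi i := by
  have key : ∀ i, ∑ x ∈ X ∩ M.sub i, M.pi x = ∑ x ∈ M.sub i, if x ∈ X then M.pi x else 0 := by
    intro i
    rw [Finset.inter_comm, Finset.sum_ite_mem]
  refine M.child_induction (C := fun i => ∑ x ∈ X ∩ M.sub i, M.pi x ≤ M.pi i) (fun i ih => ?_) i
  by_cases hi : i ∈ X
  · have : X ∩ M.sub i = {i} := by
      ext x
      simp only [Finset.mem_inter, mem_sub, Finset.mem_singleton]
      constructor
      · rintro ⟨hx, hix⟩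
        exact (hX i hi x hx hix).symm
      · rintro rfl
        exact ⟨hi, M.isAnc_refl _⟩
    simp [this]
  · rw [key, M.sum_sub, if_neg hi, zero_add]
    simp_rw [key] at ih
    have h1 := Finset.sum_le_sum fun k hk => ih k (M.mem_child.1 hk)
    have h2 := M.sum_child_pi_le i
    have h3 := mul_nonneg (M.pi_pos i).le hθ
    linarith

theorem sum_inter_sub_pi_le_of_notMem [DecidableEq S] {X : Finset S}
    (hX : ∀ i ∈ X, ∀ k ∈ X, M.IsAnc i k → i = k) (hθ : 0 ≤ M.theta) {i : S} (hi : i ∉ X) :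
    ∑ x ∈ X ∩ M.sub i, M.pi x ≤ M.pi i * (1 - M.theta) := by
  have key : ∀ i, ∑ x ∈ X ∩ M.sub i, M.pi x = ∑ x ∈ M.sub i, if x ∈ X then M.pi x else 0 := by
    intro i
    rw [Finset.inter_comm, Finset.sum_ite_mem]
  rw [key, M.sum_sub, if_neg hi, zero_add]
  refine le_trans (Finset.sum_le_sum fun k _ => ?_) (M.sum_child_pi_le i)
  rw [← key]
  exact M.sum_inter_sub_pi_le hX hθ k

/-! ### Top sets -/

theorem top_subset (X : Finset S) : M.top X ⊆ X := fun _ hi => (M.mem_top.1 hi).1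

theorem subset_subSet (X : Finset S) : X ⊆ M.subSet X := fun i hi =>
  M.mem_subSet.2 ⟨i, hi, M.isAnc_refl i⟩

theorem top_antichain (X : Finset S) : ∀ i ∈ M.top X, ∀ k ∈ M.top X, M.IsAnc i k → i = k :=
  fun _ hi _ hk h => (M.mem_top.1 hk).2 _ (M.mem_top.1 hi).1 h

theorem exists_top_isAnc {X : Finset S} {x : S} (hx : x ∈ M.subSet X) :
    ∃ i ∈ M.top X, M.IsAnc i x := by
  obtain ⟨y, hy, hyx⟩ := M.mem_subSet.1 hx
  have := ((M.isTop_iff _ X).2 rfl).2.1 hy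
  obtain ⟨i, hi, hiy⟩ := M.mem_subSet.1 this
  exact ⟨i, hi, hiy.trans hyx⟩

theorem top_insert_of_mem [DecidableEq S] {X : Finset S} {x : S} (hx : x ∈ M.subSet X) :
    M.top (insert x X) = M.top X := by
  by_cases hxX : x ∈ X
  · rw [Finset.insert_eq_of_mem hxX]
  obtain ⟨y, hy, hyx⟩ := M.mem_subSet.1 hx
  ext i
  simp only [mem_top, Finset.mem_insert]
  constructor
  · rintro ⟨rfl | hi, h⟩
    · exact absurd (h y (Or.inr hy) hyx) (by rintro rfl; exact hxX hy)
    · exact ⟨hi, fun k hk => h k (Or.inr hk)⟩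
  · rintro ⟨hi, h⟩
    refine ⟨Or.inr hi, ?_⟩
    rintro k (rfl | hk) hki
    · have := h y hy (hyx.trans hki)
      subst this
      exact M.isAnc_antisymm hki hyx
    · exact h k hk hki

theorem top_insert_of_notMem [DecidableEq S] {X : Finset S} {x : S} (hx : x ∉ M.subSet X) :
    M.top (insert x X) = insert x (M.top X \ M.sub x) := by
  have hxX : ∀ y ∈ X, ¬ M.IsAnc y x := fun y hy h => hx (M.mem_subSet.2 ⟨y, hy, h⟩)
  ext i
  simp only [mem_top, Finset.mem_insert, Finset.mem_sdiff, mem_sub]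
  constructor
  · rintro ⟨rfl | hi, h⟩
    · exact Or.inl rfl
    · by_cases hxi : M.IsAnc x i
      · exact Or.inl (h x (Or.inl rfl) hxi).symm
      · exact Or.inr ⟨⟨hi, fun k hk => h k (Or.inr hk)⟩, hxi⟩
  · rintro (rfl | ⟨⟨hi, h⟩, hxi⟩)
    · refine ⟨Or.inl rfl, ?_⟩
      rintro k (rfl | hk) hki
      · rfl
      · exact absurd hki (hxX k hk)
    · refine ⟨Or.inr hi, ?_⟩
      rintro k (rfl | hk) hki
      · exact absurd hki hxi
      · exact h k hk hki

/-! ### The water-filling cut -/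

section Cut

variable (lam mu : ℝ) (o : Fin (Fintype.card S) ≃ S)

theorem load_cut_le (hmu : 0 ≤ mu) : M.load lam o (M.cut lam mu o) ≤ mu := by
  classical
  have h0 : M.load lam o 0 ≤ mu := by
    have : M.top (first o 0) = ∅ := by
      ext i
      simp [mem_top, mem_first]
    rw [load, this]
    simpa using hmu
  have := Nat.findGreatest_spec (P := fun m => M.load lam o m ≤ mu) (Nat.zero_le (Fintype.card S)) h0
  simpa [cut] using this

variable {lam mu o}

theorem partialNode_spec {r : S} (h : M.partialNode lam mu o = some r) :
    ∃ hc : M.cut lam mu o < Fintype.card S, o ⟨M.cut lam mu o, hc⟩ = r := by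
  unfold partialNode at h
  split at h
  · rename_i hc
    exact ⟨hc.1, Option.some.inj h⟩
  · cases h

theorem mem_first_succ_cut {r : S} (h : M.partialNode lam mu o = some r) {i : S} :
    i ∈ first o (M.cut lam mu o + 1) ↔ i = r ∨ i ∈ M.served lam mu o := by
  obtain ⟨hc, rfl⟩ := M.partialNode_spec h
  rw [served, mem_first, mem_first, Nat.lt_succ_iff, le_iff_eq_or_lt, ← Equiv.symm_apply_eq,
    Fin.ext_iff]

open Classical in
theorem lt_load_insert {r : S} (h : M.partialNode lam mu o = some r) :
    mu < ∑ i ∈ M.top (insert r (M.served lam mu o)), lam * M.pi i := by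
  obtain ⟨hc, -⟩ := M.partialNode_spec h
  have h1 : first o (M.cut lam mu o + 1) = insert r (M.served lam mu o) := by
    ext i
    rw [M.mem_first_succ_cut h, Finset.mem_insert]
  rw [← h1]
  have := Nat.findGreatest_is_greatest (P := fun m => M.load lam o m ≤ mu)
    (Nat.lt_succ_self (M.cut lam mu o)) (by omega)
  simpa [load] using this

theorem partialNode_notMem_subSet (hmu : 0 ≤ mu) {r : S} (h : M.partialNode lam mu o = some r) :
    r ∉ M.subSet (M.served lam mu o) := by
  classical
  intro hr
  have h1 := M.lt_load_insert h
  have h2 := M.load_cut_le lam mu o hmu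
  rw [M.top_insert_of_mem hr] at h1
  exact absurd h1 (not_lt.2 h2)

open Classical in
theorem pi_mul_kappa (r : S) : M.pi r * M.kappa lam mu o r =
    M.pi r - ∑ i ∈ M.top (M.served lam mu o) ∩ M.sub r, M.pi i := by
  rw [kappa, ← Finset.sum_div, mul_sub, mul_one, mul_div_cancel₀ _ (M.pi_pos r).ne']

theorem lt_lam_mul (hmu : 0 ≤ mu) {r : S} (h : M.partialNode lam mu o = some r) :
    mu < lam * (∑ i ∈ M.top (M.served lam mu o), M.pi i + M.pi r * M.kappa lam mu o r) := by
  classical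
  have h1 := M.lt_load_insert h
  have hr := M.partialNode_notMem_subSet hmu h
  rw [M.top_insert_of_notMem hr, Finset.sum_insert, ← Finset.mul_sum] at h1
  · rw [M.pi_mul_kappa]
    have := Finset.sum_inter_add_sum_sdiff (M.top (M.served lam mu o)) (M.sub r) M.pi
    refine h1.trans_eq ?_
    linear_combination lam * this
  · simp [M.mem_sub, M.isAnc_refl]

theorem theta_le_kappa (hmu : 0 ≤ mu) (hθ : 0 ≤ M.theta) {r : S}
    (h : M.partialNode lam mu o = some r) : M.theta ≤ M.kappa lam mu o r := by
  classical
  have hr := M.partialNode_notMem_subSet hmu h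
  have hr' : r ∉ M.top (M.served lam mu o) := fun h' =>
    hr (M.subset_subSet _ (M.top_subset _ h'))
  have h1 := M.sum_inter_sub_pi_le_of_notMem (M.top_antichain _) hθ hr'
  have h2 := M.pi_mul_kappa (lam := lam) (mu := mu) (o := o) r
  have h3 := M.pi_pos r
  refine le_of_mul_le_mul_left ?_ h3
  rw [h2]
  linarith

end Cut

/-! ### Flow into a set of states -/

section Flow

variable (cut : Option S) (X : Finset S)

open Classical in
/-- The probability that a job in state `i`, if never served, is in `X` after `s` steps and does
not start from or visit the state `cut` in the meantime. -/
def hit : ℕ → S → ℝ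
  | 0, i => if i ∈ X then 1 else 0
  | s + 1, i => if cut = some i then 0 else ∑ k, M.P i k * hit s k

open Classical in
/-- The probability that a job in state `i`, if never served, is in `X` after `s` steps and does
not return to `cut` in the meantime, if `i` is the state `cut`, and `0` otherwise. -/
def hitFromCut : ℕ → S → ℝ
  | 0, _ => 0
  | s + 1, i => if cut = some i then ∑ k, M.P i k * M.hit cut X s k else 0

open Classical in
theorem hit_succ (s : ℕ) (i : S) : M.hit cut X (s + 1) i =
    if cut = some i then 0 else ∑ k, M.P i k * M.hit cut X s k := by
  rw [hit]

open Classical in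
theorem hitFromCut_succ (s : ℕ) (i : S) : M.hitFromCut cut X (s + 1) i =
    if cut = some i then ∑ k, M.P i k * M.hit cut X s k else 0 := by
  rw [hitFromCut]

theorem hit_nonneg (s : ℕ) (i : S) : 0 ≤ M.hit cut X s i := by
  induction s generalizing i with
  | zero => unfold hit; split <;> norm_num
  | succ s ih =>
    rw [hit_succ]
    split
    · exact le_rfl
    · exact Finset.sum_nonneg fun k _ => mul_nonneg (M.P_nonneg _ _) (ih k)

theorem hitFromCut_nonneg (s : ℕ) (i : S) : 0 ≤ M.hitFromCut cut X s i := by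
  cases s with
  | zero => exact le_rfl
  | succ s =>
    rw [hitFromCut_succ]
    split
    · exact Finset.sum_nonneg fun k _ => mul_nonneg (M.P_nonneg _ _) (M.hit_nonneg _ _ _ _)
    · exact le_rfl

theorem hitFromCut_none (s : ℕ) (i : S) : M.hitFromCut none X s i = 0 := by
  cases s <;> simp [hitFromCut]

theorem hitFromCut_of_ne {r i : S} (h : i ≠ r) (s : ℕ) : M.hitFromCut (some r) X s i = 0 := by
  cases s <;> simp [hitFromCut, h.symm]

theorem hit_add_hitFromCut (s : ℕ) (i : S) :
    M.hit cut X (s + 1) i + M.hitFromCut cut X (s + 1) i = ∑ k, M.P i k * M.hit cut X s k := by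
  rw [hit_succ, hitFromCut_succ]
  split <;> simp

variable {cut X}

open Classical in
theorem pi_mul_sum_hit_le {H : S → ℝ} (h0 : ∀ i, 0 ≤ H i)
    (hH : ∀ i, ((if i ∈ X then M.pi i else 0) +
      if cut = some i then 0 else ∑ k ∈ M.child i, H k) ≤ H i) (n : ℕ) (i : S) :
    M.pi i * ∑ s ∈ Finset.range n, M.hit cut X s i ≤ H i := by
  induction n generalizing i with
  | zero => simpa using h0 i
  | succ n ih =>
    refine le_trans ?_ (hH i)
    rw [Finset.sum_range_succ', mul_add, add_comm]
    refine add_le_add ?_ ?_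
    · simp [hit]
    · simp only [hit_succ]
      split
      · simp
      · rw [Finset.sum_comm, Finset.mul_sum, ← Finset.sum_subset (Finset.subset_univ (M.child i))]
        · refine Finset.sum_le_sum fun k hk => ?_
          rw [← Finset.mul_sum, ← mul_assoc, ← M.pi_child (M.mem_child.1 hk)]
          exact ih k
        · intro k _ hk
          simp [M.P_eq_zero k i (fun h => hk (M.mem_child.2 h))]

theorem sum_hit_root_none_le (n : ℕ) :
    ∑ s ∈ Finset.range n, M.hit none X s M.root ≤ ∑ x ∈ X, M.pi x := by
  classical
  have h := M.pi_mul_sum_hit_le (cut := none) (X := X)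
    (H := fun i => ∑ x ∈ M.sub i, if x ∈ X then M.pi x else 0)
    (fun i => Finset.sum_nonneg fun x _ => by split <;> simp [(M.pi_pos x).le])
    (fun i => by simp [M.sum_sub i]) n M.root
  simpa [pi_root, sub_root] using h

open Classical in
theorem sum_hit_some_aux (r : S) (n : ℕ) (i : S) :
    M.pi i * ∑ s ∈ Finset.range n, M.hit (some r) X s i ≤
      (∑ x ∈ M.sub i, if x ∈ X then M.pi x else 0) -
        if M.IsAnc i r then ∑ k ∈ M.child r, ∑ x ∈ M.sub k, if x ∈ X then M.pi x else 0
        else 0 := by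
  have hpos : ∀ i, 0 ≤ ∑ x ∈ M.sub i, if x ∈ X then M.pi x else 0 := fun i =>
    Finset.sum_nonneg fun x _ => by split <;> simp [(M.pi_pos x).le]
  have hC : 0 ≤ ∑ k ∈ M.child r, ∑ x ∈ M.sub k, if x ∈ X then M.pi x else 0 :=
    Finset.sum_nonneg fun k _ => hpos k
  refine M.pi_mul_sum_hit_le (cut := some r) (X := X) (H := fun i =>
      (∑ x ∈ M.sub i, if x ∈ X then M.pi x else 0) -
        if M.IsAnc i r then ∑ k ∈ M.child r, ∑ x ∈ M.sub k, if x ∈ X then M.pi x else 0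
        else 0) (fun i => ?_) (fun i => ?_) n i
  · split
    · rename_i hi
      have h1 : ∑ k ∈ M.child r, ∑ x ∈ M.sub k, (if x ∈ X then M.pi x else 0) ≤
          ∑ x ∈ M.sub r, if x ∈ X then M.pi x else 0 := by
        rw [M.sum_sub r]
        exact le_add_of_nonneg_left (by split <;> simp [(M.pi_pos r).le])
      have h2 : ∑ x ∈ M.sub r, (if x ∈ X then M.pi x else 0) ≤
          ∑ x ∈ M.sub i, if x ∈ X then M.pi x else 0 :=
        Finset.sum_le_sum_of_subset_of_nonneg
          (fun x hx => M.mem_sub.2 (hi.trans (M.mem_sub.1 hx)))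
          fun x _ _ => by split <;> simp [(M.pi_pos x).le]
      linarith
    · simpa using hpos i
  · by_cases hir : r = i
    · subst hir
      rw [if_pos rfl, if_pos (M.isAnc_refl r), M.sum_sub r]
      linarith
    · rw [if_neg (show ¬ some r = some i by simpa using hir), M.sum_sub i, Finset.sum_sub_distrib, ← add_sub_assoc]
      refine sub_le_sub_left ?_ _
      split
      · rename_i hi
        obtain h | ⟨k, hk, hkr⟩ := M.isAnc_iff_child.1 hi
        · exact absurd h hir
        · refine le_trans ?_ (Finset.single_le_sum (fun k _ => ?_) (M.mem_child.2 hk))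
          · rw [if_pos hkr]
          · split
            · exact hC
            · exact le_rfl
      · refine Finset.sum_nonneg fun k _ => ?_
        split
        · exact hC
        · exact le_rfl

open Classical in
theorem sum_child_sub (r : S) (hr : r ∈ X) :
    ∑ k ∈ M.child r, ∑ x ∈ M.sub k, (if x ∈ X then M.pi x else 0) =
      ∑ x ∈ X ∩ M.sub r, M.pi x - M.pi r := by
  have h := M.sum_sub r fun x => if x ∈ X then M.pi x else 0
  rw [if_pos hr, Finset.sum_ite_mem, Finset.inter_comm] at h
  linarith

open Classical in
theorem sum_hit_root_some_le {r : S} (hr : r ∈ X) (n : ℕ) :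
    ∑ s ∈ Finset.range n, M.hit (some r) X s M.root ≤
      ∑ x ∈ X, M.pi x - (∑ x ∈ X ∩ M.sub r, M.pi x - M.pi r) := by
  have h := M.sum_hit_some_aux (X := X) r n M.root
  rw [if_pos (M.isAnc_root r), M.sum_child_sub r hr] at h
  simpa [pi_root, sub_root] using h

open Classical in
theorem pi_mul_sum_hitFromCut_le {r : S} (hr : r ∈ X) (n : ℕ) :
    M.pi r * ∑ s ∈ Finset.range n, M.hitFromCut (some r) X (s + 1) r ≤
      ∑ x ∈ X ∩ M.sub r, M.pi x - M.pi r := by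
  rw [← M.sum_child_sub r hr]
  simp only [hitFromCut_succ, if_true]
  rw [Finset.sum_comm, Finset.mul_sum, ← Finset.sum_subset (Finset.subset_univ (M.child r))]
  · refine Finset.sum_le_sum fun k hk => ?_
    rw [← Finset.mul_sum, ← mul_assoc, ← M.pi_child (M.mem_child.1 hk)]
    refine (M.sum_hit_some_aux (X := X) r n k).trans_eq ?_
    rw [if_neg (M.not_isAnc_of_parent (M.mem_child.1 hk)), sub_zero]
  · intro k _ hk
    simp [M.P_eq_zero k r (fun h => hk (M.mem_child.2 h))]

end Flow

end TreeChain

/-! ### Expectations with respect to discrete laws -/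

section Expectation

variable {α β : Type*}

/-- The expectation of `f` under the discrete law `q`. -/
def ev (q : PMF α) (f : α → ℝ≥0∞) : ℝ≥0∞ := ∑' a, q a * f a

theorem ev_mono_of_support {q : PMF α} {f g : α → ℝ≥0∞} (h : ∀ a ∈ q.support, f a ≤ g a) :
    ev q f ≤ ev q g := by
  refine ENNReal.tsum_le_tsum fun a => ?_
  by_cases ha : q a = 0
  · simp [ha]
  · exact mul_le_mul_right (h a ((q.mem_support_iff a).2 ha)) _

theorem ev_mono {q : PMF α} {f g : α → ℝ≥0∞} (h : ∀ a, f a ≤ g a) : ev q f ≤ ev q g :=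
  ev_mono_of_support fun a _ => h a

theorem ev_add (q : PMF α) (f g : α → ℝ≥0∞) : ev q (fun a => f a + g a) = ev q f + ev q g := by
  simp only [ev, mul_add, ENNReal.tsum_add]

theorem ev_const_mul (q : PMF α) (c : ℝ≥0∞) (f : α → ℝ≥0∞) :
    ev q (fun a => c * f a) = c * ev q f := by
  simp only [ev, mul_left_comm _ c, ENNReal.tsum_mul_left]

theorem ev_mul_const (q : PMF α) (c : ℝ≥0∞) (f : α → ℝ≥0∞) :
    ev q (fun a => f a * c) = ev q f * c := by
  simp only [ev, ← mul_assoc, ENNReal.tsum_mul_right]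

theorem ev_const (q : PMF α) (c : ℝ≥0∞) : ev q (fun _ => c) = c := by
  simp only [ev, ENNReal.tsum_mul_right, q.tsum_coe, one_mul]

theorem ev_finset_sum {ι : Type*} (q : PMF α) (s : Finset ι) (f : ι → α → ℝ≥0∞) :
    ev q (fun a => ∑ i ∈ s, f i a) = ∑ i ∈ s, ev q (f i) := by
  simp only [ev, Finset.mul_sum]
  exact Summable.tsum_finsetSum fun _ _ => ENNReal.summable

theorem ev_pure (a : α) (f : α → ℝ≥0∞) : ev (PMF.pure a) f = f a := by
  rw [ev, tsum_eq_single a]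
  · simp
  · intro b hb
    simp [hb]

theorem ev_bind (q : PMF α) (k : α → PMF β) (f : β → ℝ≥0∞) :
    ev (q.bind k) f = ev q fun a => ev (k a) f := by
  simp only [ev, PMF.bind_apply, ← ENNReal.tsum_mul_right, ← ENNReal.tsum_mul_left]
  rw [ENNReal.tsum_comm]
  simp only [mul_assoc]

theorem ev_map (q : PMF α) (k : α → β) (f : β → ℝ≥0∞) : ev (q.map k) f = ev q fun a => f (k a) := by
  rw [PMF.map, ev_bind]
  simp only [Function.comp, ev_pure]

end Expectation

/-! ### The binomial distribution -/

theorem bin_apply (N : ℕ) (x : unitInterval) (k : ℕ) :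
    bin N x k = ENNReal.ofReal (N.choose k * (x : ℝ) ^ k * (1 - x) ^ (N - k)) := by
  rw [bin, MeasureTheory.Measure.toPMF_apply, ProbabilityTheory.binomial_singleton]

theorem ev_bin (N : ℕ) (x : unitInterval) (f : ℕ → ℝ) (hf : ∀ k, 0 ≤ f k) :
    ev (bin N x) (fun k => ENNReal.ofReal (f k)) =
      ENNReal.ofReal (∑ k ∈ Finset.range (N + 1),
        N.choose k * (x : ℝ) ^ k * (1 - x) ^ (N - k) * f k) := by
  have h1 : (0 : ℝ) ≤ 1 - x := sub_nonneg.2 x.2.2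
  have h0 := x.2.1
  rw [ev, tsum_eq_sum (s := Finset.range (N + 1)), ENNReal.ofReal_sum_of_nonneg]
  · refine Finset.sum_congr rfl fun k _ => ?_
    rw [bin_apply, ← ENNReal.ofReal_mul (by positivity)]
  · intro k _
    have := hf k
    positivity
  · intro k hk
    rw [bin_apply, Nat.choose_eq_zero_of_lt (by simpa using hk)]
    simp

theorem ev_bin_pow (N : ℕ) (x : unitInterval) {u : ℝ} (hu : 0 ≤ u) :
    ev (bin N x) (fun k => ENNReal.ofReal u ^ k) = ENNReal.ofReal ((1 + x * (u - 1)) ^ N) := by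
  simp only [← ENNReal.ofReal_pow hu]
  rw [ev_bin N x _ fun k => pow_nonneg hu k]
  congr 1
  rw [show 1 + (x : ℝ) * (u - 1) = x * u + (1 - x) by ring, add_pow]
  refine Finset.sum_congr rfl fun k _ => ?_
  ring

theorem ev_bin_id (N : ℕ) (x : unitInterval) :
    ev (bin N x) (fun k => (k : ℝ≥0∞)) = ENNReal.ofReal (N * x) := by
  have h : ∀ k : ℕ, (k : ℝ≥0∞) = ENNReal.ofReal (k : ℝ) := fun k => (ENNReal.ofReal_natCast k).symm
  simp only [h]
  rw [ev_bin N x _ fun k => Nat.cast_nonneg k]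
  congr 1
  have := congrArg (Polynomial.eval (x : ℝ)) (bernsteinPolynomial.sum_smul ℝ N)
  rw [Polynomial.eval_finsetSum] at this
  simp only [bernsteinPolynomial, nsmul_eq_mul, Polynomial.eval_mul, Polynomial.eval_natCast,
    Polynomial.eval_pow, Polynomial.eval_X, Polynomial.eval_sub, Polynomial.eval_one] at this
  rw [← this]
  refine Finset.sum_congr rfl fun k _ => ?_
  ring

/-- The exponential bound for the number of arrivals. -/
theorem ev_bin_pow_le (N : ℕ) (x : unitInterval) {u : ℝ} (hu : 0 ≤ u) :
    ev (bin N x) (fun k => ENNReal.ofReal u ^ k) ≤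
      ENNReal.ofReal (Real.exp (N * (x * (u - 1)))) := by
  rw [ev_bin_pow N x hu]
  refine ENNReal.ofReal_le_ofReal ?_
  rw [Real.exp_nat_mul]
  refine pow_le_pow_left₀ ?_ (by linarith [Real.add_one_le_exp ((x : ℝ) * (u - 1))]) N
  nlinarith [x.2.1, x.2.2]

/-! ### One period -/

section Service

variable {S : Type*}

theorem countState_eq_sum [DecidableEq S] (Q : Finset (Job S)) (i : S) :
    countState Q i = ∑ j ∈ Q, if j.state = i then 1 else 0 := by
  classical
  rw [countState, Finset.card_filter]
  congr! 2

theorem natCast_countState [DecidableEq S] (Q : Finset (Job S)) (i : S) :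
    (countState Q i : ℝ≥0∞) = ∑ j ∈ Q, if j.state = i then 1 else 0 := by
  rw [countState_eq_sum]
  push_cast
  rfl

theorem countState_mono {Q Q' : Finset (Job S)} (h : Q ⊆ Q') (i : S) :
    countState Q i ≤ countState Q' i := by
  classical
  exact Finset.card_le_card (Finset.filter_subset_filter _ h)

theorem remaining_subset (x : Period S) : x.remaining ⊆ x.queue := by
  classical
  exact Finset.sdiff_subset

variable (N : ℕ) (mu : unitInterval) (A : Policy S)

theorem ev_serve (h : List (Period S)) (Q : Finset (Job S)) (φ : Period S → ℝ≥0∞) :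
    ev (serve N mu A h Q) φ = ev (bin N mu) fun R => ev (A h Q R) fun X => φ ⟨Q, R, X⟩ := by
  simp only [serve, ev_bind, ev_map]

/-- The servers are independent of the queue. -/
theorem ev_serve_mul (h : List (Period S)) (Q : Finset (Job S)) (φ : Finset (Job S) → ℝ≥0∞)
    (ψ : ℕ → ℝ≥0∞) :
    ev (serve N mu A h Q) (fun x => φ x.queue * ψ x.servers) = φ Q * ev (bin N mu) ψ := by
  simp only [ev_serve, ev_const, ev_const_mul]

end Service

section OnePeriod

variable {S : Type*} [Fintype S] {L : ℕ} (M : TreeChain S L)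

/-- The expectation of `v` after one transition from `i`. -/
theorem ev_step (i : S) (v : Option S → ℝ≥0∞) :
    ev (M.step i) v = ENNReal.ofReal (M.abandon i) * v none +
      ∑ k, ENNReal.ofReal (M.P i k) * v (some k) := by
  rw [ev, tsum_fintype, Fintype.sum_option]
  simp [TreeChain.step, PMF.ofFintype_apply]

theorem ev_moves_prod (Z : Finset (Job S)) (v : Z → Option S → ℝ≥0∞) :
    ev (moves M Z) (fun f => ∏ j, v j (f j)) = ∏ j : Z, ev (M.step j.1.state) (v j) := by
  classical
  simp only [ev, tsum_fintype]
  rw [Finset.prod_univ_sum, Fintype.piFinset_univ]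
  refine Finset.sum_congr rfl fun f _ => ?_
  simp only [moves, PMF.ofFintype_apply]
  rw [Finset.prod_mul_distrib]

theorem ev_moves_sum (Z : Finset (Job S)) (v : Option S → ℝ≥0∞) :
    ev (moves M Z) (fun f => ∑ j, v (f j)) = ∑ j : Z, ev (M.step j.1.state) v := by
  classical
  rw [ev_finset_sum]
  refine Finset.sum_congr rfl fun j _ => ?_
  have h := ev_moves_prod M Z (fun i => if i = j then v else fun _ => 1)
  rw [Finset.prod_eq_single j] at h
  · rw [if_pos rfl] at h
    rw [← h]
    congr 1
    ext f
    rw [Finset.prod_eq_single j]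
    · simp
    · intro b _ hb
      simp [hb]
    · simp
  · intro b _ hb
    simp [hb, ev_const]
  · simp

@[to_additive]
theorem prod_biUnion_le_of_one_le {ι κ R : Type*} [DecidableEq κ] [CommMonoid R] [PartialOrder R]
    [MulLeftMono R] (s : Finset ι) (t : ι → Finset κ) (u : κ → R) (hu : ∀ a, 1 ≤ u a) :
    ∏ a ∈ s.biUnion t, u a ≤ ∏ i ∈ s, ∏ a ∈ t i, u a := by
  classical
  induction s using Finset.induction_on with
  | empty => simp
  | insert i s hi ih =>
    rw [Finset.biUnion_insert, Finset.prod_insert hi]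
    refine le_trans ?_ (mul_le_mul_right ih _)
    rw [← Finset.prod_union_inter]
    exact le_mul_of_one_le_right' (Finset.one_le_prod' fun a _ => hu a)

@[to_additive]
theorem prod_nextQueue_le {R : Type*} [CommMonoid R] [PartialOrder R] [MulLeftMono R]
    (t : ℕ) (Z : Finset (Job S)) (f : Z → Option S) (a : ℕ) (u : S → R) (hu : ∀ i, 1 ≤ u i) :
    ∏ j ∈ nextQueue M t Z f a, u j.state ≤ (∏ j, (f j).elim 1 u) * u M.root ^ a := by
  classical
  have h1 : ∀ s t : Finset (Job S),
      ∏ j ∈ s ∪ t, u j.state ≤ (∏ j ∈ s, u j.state) * ∏ j ∈ t, u j.state := fun s t => by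
    rw [← Finset.prod_union_inter]
    exact le_mul_of_one_le_right' (Finset.one_le_prod' fun a _ => hu _)
  refine (h1 _ _).trans (mul_le_mul' ?_ ?_)
  · refine (prod_biUnion_le_of_one_le _ _ (fun j : Job S => u j.state) fun j => hu _).trans ?_
    refine Finset.prod_le_prod' fun j _ => ?_
    cases f j <;> simp
  · rw [← Finset.biUnion_singleton]
    refine (prod_biUnion_le_of_one_le _ _ (fun j : Job S => u j.state) fun j => hu _).trans ?_
    simp

variable (N : ℕ) (lam mu : unitInterval) (A : Policy S)

theorem ev_nextPeriod_nil_mul (φ : Finset (Job S) → ℝ≥0∞) (ψ : ℕ → ℝ≥0∞) :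
    ev (nextPeriod M N lam mu A []) (fun x => φ x.queue * ψ x.servers) =
      φ ∅ * ev (bin N mu) ψ := by
  rw [nextPeriod, ev_serve_mul]

theorem ev_nextPeriod_cons_mul (x : Period S) (h : List (Period S)) (φ : Finset (Job S) → ℝ≥0∞)
    (ψ : ℕ → ℝ≥0∞) :
    ev (nextPeriod M N lam mu A (x :: h)) (fun x => φ x.queue * ψ x.servers) =
      (ev (moves M x.remaining) fun f => ev (bin N lam) fun a =>
        φ (nextQueue M (h.length + 1) x.remaining f a)) * ev (bin N mu) ψ := by
  simp only [nextPeriod, ev_bind, ev_serve_mul, ev_mul_const]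

theorem ev_nextPeriod_nil_queue (φ : Finset (Job S) → ℝ≥0∞) :
    ev (nextPeriod M N lam mu A []) (fun x => φ x.queue) = φ ∅ := by
  simpa [ev_const] using ev_nextPeriod_nil_mul M N lam mu A φ fun _ => 1

theorem ev_nextPeriod_cons_queue (x : Period S) (h : List (Period S))
    (φ : Finset (Job S) → ℝ≥0∞) :
    ev (nextPeriod M N lam mu A (x :: h)) (fun x => φ x.queue) =
      ev (moves M x.remaining) fun f => ev (bin N lam) fun a =>
        φ (nextQueue M (h.length + 1) x.remaining f a) := by
  simpa [ev_const] using ev_nextPeriod_cons_mul M N lam mu A x h φ fun _ => 1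

theorem ev_queue_prod_le (x : Period S) (h : List (Period S)) (u : S → ℝ≥0∞)
    (hu : ∀ i, 1 ≤ u i) :
    ev (nextPeriod M N lam mu A (x :: h)) (fun x => ∏ j ∈ x.queue, u j.state) ≤
      (∏ j ∈ x.remaining, ev (M.step j.state) (fun k => k.elim 1 u)) *
        ev (bin N lam) fun a => u M.root ^ a := by
  rw [ev_nextPeriod_cons_queue M N lam mu A x h fun Q => ∏ j ∈ Q, u j.state,
    ← Finset.prod_coe_sort, ← ev_moves_prod M x.remaining fun _ k => k.elim 1 u, ← ev_mul_const]
  refine ev_mono fun f => ?_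
  rw [← ev_const_mul]
  exact ev_mono fun a => prod_nextQueue_le M _ _ f a u hu

theorem ev_queue_sum_le (x : Period S) (h : List (Period S)) (c : S → ℝ≥0∞) :
    ev (nextPeriod M N lam mu A (x :: h)) (fun x => ∑ j ∈ x.queue, c j.state) ≤
      (∑ j ∈ x.remaining, ∑ k, ENNReal.ofReal (M.P j.state k) * c k) +
        ENNReal.ofReal (N * lam) * c M.root := by
  rw [ev_nextPeriod_cons_queue M N lam mu A x h fun Q => ∑ j ∈ Q, c j.state]
  have h1 : ∀ i, ev (M.step i) (fun k => k.elim 0 c) = ∑ k, ENNReal.ofReal (M.P i k) * c k := by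
    intro i
    simp [ev_step]
  calc _ ≤ ev (moves M x.remaining) fun f => ev (bin N lam) fun a =>
        ∑ j, (f j).elim 0 c + (a : ℝ≥0∞) * c M.root := by
        refine ev_mono fun f => ev_mono fun a => ?_
        have := sum_nextQueue_le M (h.length + 1) _ f a c fun i => zero_le
        simpa using this
    _ = _ := by
        simp only [ev_add, ev_const, ev_mul_const, ev_bin_id]
        rw [ev_moves_sum M x.remaining fun k => k.elim 0 c]
        simp only [h1]
        rw [Finset.sum_coe_sort x.remaining fun j => ∑ k, ENNReal.ofReal (M.P j.state k) * c k]

end OnePeriod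

/-! ### Mean values in a period -/

section Mean

variable {S : Type*} [Fintype S] {L : ℕ} (M : TreeChain S L)
variable (N : ℕ) (lam mu : unitInterval) (A : Policy S)

/-- The expectation of `φ` of the period number `t + 1`. -/
def mean (t : ℕ) (φ : Period S → ℝ≥0∞) : ℝ≥0∞ :=
  ev (historyLaw M N lam mu A t) fun h => ev (nextPeriod M N lam mu A h) φ

theorem ev_historyLaw_zero (F : List (Period S) → ℝ≥0∞) :
    ev (historyLaw M N lam mu A 0) F = F [] := by
  rw [historyLaw, ev_pure]

theorem ev_historyLaw_succ (t : ℕ) (F : List (Period S) → ℝ≥0∞) :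
    ev (historyLaw M N lam mu A (t + 1)) F =
      ev (historyLaw M N lam mu A t) fun h => ev (nextPeriod M N lam mu A h) fun x => F (x :: h) := by
  rw [historyLaw, ev_bind]
  simp only [ev_map]

theorem mean_add (t : ℕ) (φ ψ : Period S → ℝ≥0∞) :
    mean M N lam mu A t (fun x => φ x + ψ x) =
      mean M N lam mu A t φ + mean M N lam mu A t ψ := by
  simp only [mean, ev_add]

theorem mean_const_mul (t : ℕ) (c : ℝ≥0∞) (φ : Period S → ℝ≥0∞) :
    mean M N lam mu A t (fun x => c * φ x) = c * mean M N lam mu A t φ := by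
  simp only [mean, ev_const_mul]

theorem mean_finset_sum {ι : Type*} (t : ℕ) (s : Finset ι) (φ : ι → Period S → ℝ≥0∞) :
    mean M N lam mu A t (fun x => ∑ i ∈ s, φ i x) = ∑ i ∈ s, mean M N lam mu A t (φ i) := by
  simp only [mean, ev_finset_sum]

theorem mean_mono (t : ℕ) {φ ψ : Period S → ℝ≥0∞} (h : ∀ x, φ x ≤ ψ x) :
    mean M N lam mu A t φ ≤ mean M N lam mu A t ψ :=
  ev_mono fun _ => ev_mono h

theorem expectedCost_eq_sum_mean (T : ℕ) :
    expectedCost M N lam mu A T = ∑ t ∈ Finset.range T, mean M N lam mu A t (periodCost M) := by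
  change ev (historyLaw M N lam mu A T) _ = _
  induction T with
  | zero => simp [ev_historyLaw_zero]
  | succ T ih =>
    rw [ev_historyLaw_succ, Finset.sum_range_succ, ← ih, add_comm]
    simp only [List.map_cons, List.sum_cons, ev_add, ev_const, mean]

theorem mean_zero_queue (c : S → ℝ≥0∞) :
    mean M N lam mu A 0 (fun x => ∑ j ∈ x.queue, c j.state) = 0 := by
  rw [mean, ev_historyLaw_zero, ev_nextPeriod_nil_queue M N lam mu A fun Q => ∑ j ∈ Q, c j.state]
  simp

theorem mean_succ_queue_le (t : ℕ) (c : S → ℝ≥0∞) :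
    mean M N lam mu A (t + 1) (fun x => ∑ j ∈ x.queue, c j.state) ≤
      mean M N lam mu A t (fun x => ∑ j ∈ x.remaining,
        ∑ k, ENNReal.ofReal (M.P j.state k) * c k) + ENNReal.ofReal (N * lam) * c M.root := by
  rw [mean, ev_historyLaw_succ]
  calc _ ≤ ev (historyLaw M N lam mu A t) fun h => ev (nextPeriod M N lam mu A h) fun x =>
        (∑ j ∈ x.remaining, ∑ k, ENNReal.ofReal (M.P j.state k) * c k) +
          ENNReal.ofReal (N * lam) * c M.root :=
        ev_mono fun h => ev_mono fun x => ev_queue_sum_le M N lam mu A x h c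
    _ = _ := by simp only [ev_add, ev_const, mean]

theorem sum_job_eq {R : Type*} [CommSemiring R] (Q : Finset (Job S)) (c : S → R) :
    ∑ j ∈ Q, c j.state = ∑ i, c i * (countState Q i : R) := by
  classical
  simp only [countState_eq_sum, Nat.cast_sum, Finset.mul_sum]
  rw [Finset.sum_comm]
  simp

/-- The expected number of jobs in state `i` that wait in one of the periods `1, …, T`. -/
def totalQueue (T : ℕ) (i : S) : ℝ≥0∞ :=
  ∑ t ∈ Finset.range T, mean M N lam mu A t fun x => (countState x.queue i : ℝ≥0∞)

/-- The expected number of jobs in state `i` that remain in one of the periods `1, …, T`. -/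
def totalRemaining (T : ℕ) (i : S) : ℝ≥0∞ :=
  ∑ t ∈ Finset.range T, mean M N lam mu A t fun x => (countState x.remaining i : ℝ≥0∞)

theorem totalRemaining_le_totalQueue (T : ℕ) (i : S) :
    totalRemaining M N lam mu A T i ≤ totalQueue M N lam mu A T i :=
  Finset.sum_le_sum fun t _ => mean_mono M N lam mu A t fun x =>
    Nat.cast_le.2 (countState_mono (remaining_subset x) i)

theorem expectedCost_eq_sum_totalRemaining (T : ℕ) :
    expectedCost M N lam mu A T =
      ∑ i, ENNReal.ofReal (M.cost i) * totalRemaining M N lam mu A T i := by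
  rw [expectedCost_eq_sum_mean]
  have h : periodCost M =
      fun x => ∑ i, ENNReal.ofReal (M.cost i) * (countState x.remaining i : ℝ≥0∞) := by
    ext x
    exact sum_job_eq x.remaining fun i => ENNReal.ofReal (M.cost i)
  rw [h]
  simp only [mean_finset_sum, mean_const_mul, totalRemaining, Finset.mul_sum]
  rw [Finset.sum_comm]

theorem mean_succ_countState_queue_le (t : ℕ) (k : S) :
    mean M N lam mu A (t + 1) (fun x => (countState x.queue k : ℝ≥0∞)) ≤
      ∑ i, ENNReal.ofReal (M.P i k) *
        mean M N lam mu A t (fun x => (countState x.remaining i : ℝ≥0∞)) +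
      ENNReal.ofReal (N * lam) * (open Classical in if M.root = k then 1 else 0) := by
  classical
  have h := mean_succ_queue_le M N lam mu A t fun i => if i = k then 1 else 0
  simp only [natCast_countState (i := k)]
  refine h.trans_eq ?_
  congr 1
  · rw [← funext fun i => mean_const_mul M N lam mu A t (ENNReal.ofReal (M.P i k))
      fun x => (countState x.remaining i : ℝ≥0∞), ← mean_finset_sum]
    congr 1
    ext x
    rw [← sum_job_eq x.remaining fun i => ENNReal.ofReal (M.P i k)]
    simp

theorem mean_zero_countState_queue (k : S) :
    mean M N lam mu A 0 (fun x => (countState x.queue k : ℝ≥0∞)) = 0 := by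
  classical
  simp only [natCast_countState]
  exact mean_zero_queue M N lam mu A fun i => if i = k then 1 else 0

theorem totalQueue_root_le (T : ℕ) :
    totalQueue M N lam mu A T M.root ≤ T * ENNReal.ofReal (N * lam) := by
  classical
  have h : ∀ t, mean M N lam mu A t (fun x => (countState x.queue M.root : ℝ≥0∞)) ≤
      ENNReal.ofReal (N * lam) := by
    rintro (_ | t)
    · simp [mean_zero_countState_queue]
    · refine (mean_succ_countState_queue_le M N lam mu A t M.root).trans ?_
      have : ∀ i, M.P i M.root = 0 := fun i =>
        M.P_eq_zero _ _ (by simp [(M.parent_eq_none _).2 rfl])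
      simp [this]
  refine (Finset.sum_le_sum fun t _ => h t).trans ?_
  simp

theorem totalQueue_child_le (T : ℕ) {i k : S} (hk : M.parent k = some i) :
    totalQueue M N lam mu A T k ≤ ENNReal.ofReal (M.P i k) * totalRemaining M N lam mu A T i := by
  classical
  cases T with
  | zero => simp [totalQueue]
  | succ T =>
    rw [totalQueue, Finset.sum_range_succ', mean_zero_countState_queue, add_zero, totalRemaining,
      Finset.sum_range_succ, mul_add, Finset.mul_sum]
    refine le_add_right (Finset.sum_le_sum fun t _ => ?_)
    refine (mean_succ_countState_queue_le M N lam mu A t k).trans_eq ?_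
    have hroot : M.root ≠ k := by
      rintro rfl
      rw [(M.parent_eq_none _).2 rfl] at hk
      cases hk
    rw [if_neg hroot, mul_zero, add_zero, Finset.sum_eq_single i]
    · intro b _ hb
      rw [M.P_eq_zero k b (by rw [hk]; simpa using hb.symm)]
      simp
    · simp

end Mean

/-! ### The exponential bound -/

section Compensator

variable {S : Type*}

/-- The weights of the jobs that remained in the past periods, where a job in state `i` that
remained `k` periods before the head of the list has weight `w (s + k) i`. -/
def histComp (w : ℕ → S → ℝ) : ℕ → List (Period S) → ℝ
  | _, [] => 0
  | s, x :: h => ∑ j ∈ x.remaining, w s j.state + histComp w (s + 1) h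

theorem histComp_nonneg {w : ℕ → S → ℝ} (hw : ∀ s i, 0 ≤ w s i) (s : ℕ) (h : List (Period S)) :
    0 ≤ histComp w s h := by
  induction h generalizing s with
  | nil => exact le_rfl
  | cons x h ih => exact add_nonneg (Finset.sum_nonneg fun j _ => hw _ _) (ih _)

theorem histComp_eq_zero {w : ℕ → S → ℝ} (hw : ∀ s i, w s i = 0) (s : ℕ) (h : List (Period S)) :
    histComp w s h = 0 := by
  induction h generalizing s with
  | nil => rfl
  | cons x h ih => simp [histComp, hw, ih]

end Compensator

section Exponential

variable {S : Type*} [Fintype S] {L : ℕ} (M : TreeChain S L)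
variable (cut : Option S) (X : Finset S)

/-- The exponential potential of a job in state `i`. -/
def potential (β : ℝ) (s : ℕ) (i : S) : ℝ≥0∞ := ENNReal.ofReal (1 + β * M.hit cut X s i)

variable {cut X}

theorem one_le_potential {β : ℝ} (hβ : 0 ≤ β) (s : ℕ) (i : S) : 1 ≤ potential M cut X β s i := by
  rw [potential, ENNReal.one_le_ofReal]
  have := mul_nonneg hβ (M.hit_nonneg cut X s i)
  linarith

theorem ev_step_potential {β : ℝ} (hβ : 0 ≤ β) (s : ℕ) (i : S) :
    ev (M.step i) (fun k => k.elim 1 (potential M cut X β s)) =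
      ENNReal.ofReal (1 + β * ∑ k, M.P i k * M.hit cut X s k) := by
  have h0 : ∀ k, 0 ≤ 1 + β * M.hit cut X s k := fun k => by
    have := mul_nonneg hβ (M.hit_nonneg cut X s k)
    linarith
  have h1 : 0 ≤ M.abandon i := by
    rw [TreeChain.abandon, ← M.sum_P]
    linarith [M.P_sum_le_one i]
  simp only [ev_step, Option.elim, mul_one, potential]
  rw [Finset.sum_congr rfl fun k _ => (ENNReal.ofReal_mul (M.P_nonneg i k)).symm,
    ← ENNReal.ofReal_sum_of_nonneg fun k _ => mul_nonneg (M.P_nonneg i k) (h0 k),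
    ← ENNReal.ofReal_add h1 (Finset.sum_nonneg fun k _ => mul_nonneg (M.P_nonneg i k) (h0 k))]
  congr 1
  simp only [mul_add, mul_one, Finset.sum_add_distrib, Finset.mul_sum]
  rw [TreeChain.abandon, ← M.sum_P, ← add_assoc, sub_add_cancel]
  congr 1
  exact Finset.sum_congr rfl fun k _ => by ring

theorem exp_mul_ev_step_le {β : ℝ} (hβ : 0 ≤ β) (s : ℕ) (i : S) :
    ENNReal.ofReal (Real.exp (-(β * M.hitFromCut cut X (s + 1) i))) *
      ev (M.step i) (fun k => k.elim 1 (potential M cut X β s)) ≤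
        potential M cut X β (s + 1) i := by
  rw [ev_step_potential M hβ, ← ENNReal.ofReal_mul (Real.exp_pos _).le, potential,
    ← M.hit_add_hitFromCut]
  refine ENNReal.ofReal_le_ofReal ?_
  have h1 := mul_nonneg hβ (M.hit_nonneg cut X (s + 1) i)
  have h2 := mul_nonneg hβ (M.hitFromCut_nonneg cut X (s + 1) i)
  have h3 := Real.add_one_le_exp (β * M.hitFromCut cut X (s + 1) i)
  rw [Real.exp_neg, inv_mul_le_iff₀ (Real.exp_pos _)]
  nlinarith

theorem exp_mul_prod_remaining_le {β : ℝ} (hβ : 0 ≤ β) (s : ℕ) (x : Period S) :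
    ENNReal.ofReal (Real.exp (-(β * ∑ j ∈ x.remaining, M.hitFromCut cut X (s + 1) j.state))) *
      ∏ j ∈ x.remaining, ev (M.step j.state) (fun k => k.elim 1 (potential M cut X β s)) ≤
        ∏ j ∈ x.queue, potential M cut X β (s + 1) j.state := by
  rw [Finset.mul_sum, ← Finset.sum_neg_distrib, Real.exp_sum,
    ENNReal.ofReal_prod_of_nonneg fun _ _ => (Real.exp_pos _).le, ← Finset.prod_mul_distrib]
  refine (Finset.prod_le_prod' fun j _ => exp_mul_ev_step_le M hβ s j.state).trans ?_
  exact Finset.prod_le_prod_of_subset_of_one_le' (remaining_subset x)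
    fun j _ _ => one_le_potential M hβ _ _

variable (N : ℕ) (lam mu : unitInterval) (A : Policy S)

theorem ev_potential_le {β : ℝ} (hβ : 0 ≤ β) (t s : ℕ) :
    ev (historyLaw M N lam mu A t) (fun h =>
      ENNReal.ofReal (Real.exp (-(β * histComp (M.hitFromCut cut X) (s + 1) h))) *
        ev (nextPeriod M N lam mu A h) fun x => ∏ j ∈ x.queue, potential M cut X β s j.state) ≤
      ENNReal.ofReal (Real.exp (β * (N * (lam *
        ∑ k ∈ Finset.range t, M.hit cut X (s + k) M.root)))) := by
  induction t generalizing s with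
  | zero =>
    rw [ev_historyLaw_zero,
      ev_nextPeriod_nil_queue M N lam mu A fun Q => ∏ j ∈ Q, potential M cut X β s j.state]
    simp [histComp]
  | succ t ih =>
    rw [ev_historyLaw_succ]
    set α := ENNReal.ofReal (Real.exp (N * (lam * (β * M.hit cut X s M.root)))) with hα
    have harr : ev (bin N lam) (fun a => potential M cut X β s M.root ^ a) ≤ α := by
      have h0 := mul_nonneg hβ (M.hit_nonneg cut X s M.root)
      refine (ev_bin_pow_le N lam (by linarith)).trans_eq ?_
      rw [add_sub_cancel_left]
    have key : ∀ h x, ENNReal.ofReal (Real.exp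
          (-(β * histComp (M.hitFromCut cut X) (s + 1) (x :: h)))) *
        ev (nextPeriod M N lam mu A (x :: h))
          (fun x => ∏ j ∈ x.queue, potential M cut X β s j.state) ≤
        ENNReal.ofReal (Real.exp (-(β * histComp (M.hitFromCut cut X) (s + 1 + 1) h))) * α *
          ∏ j ∈ x.queue, potential M cut X β (s + 1) j.state := by
      intro h x
      rw [histComp, mul_add, neg_add, Real.exp_add, ENNReal.ofReal_mul (Real.exp_pos _).le]
      set e1 := ENNReal.ofReal (Real.exp
        (-(β * ∑ j ∈ x.remaining, M.hitFromCut cut X (s + 1) j.state)))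
      set e2 := ENNReal.ofReal (Real.exp
        (-(β * histComp (M.hitFromCut cut X) (s + 1 + 1) h)))
      set π := ∏ j ∈ x.remaining,
        ev (M.step j.state) (fun k => k.elim 1 (potential M cut X β s)) with hπ
      calc _ ≤ e1 * e2 * (π * α) := by
            gcongr
            refine (ev_queue_prod_le M N lam mu A x h _ fun i => one_le_potential M hβ s i).trans ?_
            exact mul_le_mul_right harr _
        _ = e2 * α * (e1 * π) := by ring
        _ ≤ _ := by
            gcongr
            exact exp_mul_prod_remaining_le M hβ s x
    calc _ ≤ ev (historyLaw M N lam mu A t) fun h => ev (nextPeriod M N lam mu A h) fun x =>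
          ENNReal.ofReal (Real.exp (-(β * histComp (M.hitFromCut cut X) (s + 1 + 1) h))) * α *
            ∏ j ∈ x.queue, potential M cut X β (s + 1) j.state :=
          ev_mono fun h => ev_mono fun x => key h x
      _ = α * ev (historyLaw M N lam mu A t) fun h =>
          ENNReal.ofReal (Real.exp (-(β * histComp (M.hitFromCut cut X) (s + 1 + 1) h))) *
            ev (nextPeriod M N lam mu A h) fun x =>
              ∏ j ∈ x.queue, potential M cut X β (s + 1) j.state := by
          simp only [ev_const_mul]
          rw [← ev_const_mul]
          congr 1
          ext h
          ring
      _ ≤ _ := mul_le_mul_right (ih (s + 1)) _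
      _ = _ := by
          rw [hα, ← ENNReal.ofReal_mul (Real.exp_pos _).le, ← Real.exp_add,
            Finset.sum_range_succ', add_zero]
          simp only [add_right_comm s 1, ← add_assoc]
          congr 2
          ring

theorem prod_potential_zero (η : ℝ) (Q : Finset (Job S)) :
    ∏ j ∈ Q, potential M cut X (Real.exp η - 1) 0 j.state =
      ENNReal.ofReal (Real.exp (η * (∑ i ∈ X, countState Q i : ℕ))) := by
  classical
  have h1 : ∀ i, potential M cut X (Real.exp η - 1) 0 i =
      ENNReal.ofReal (Real.exp (η * if i ∈ X then 1 else 0)) := by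
    intro i
    rw [potential, TreeChain.hit]
    split <;> simp
  have h2 := sum_job_eq Q fun i => η * if i ∈ X then 1 else 0
  simp only [h1]
  rw [← ENNReal.ofReal_prod_of_nonneg fun _ _ => (Real.exp_pos _).le, ← Real.exp_sum, h2]
  congr 2
  push_cast
  rw [Finset.mul_sum]
  simp [Finset.sum_ite_mem]

theorem natSub_le_exp (n R : ℕ) {a c η β : ℝ} (ha : 0 ≤ a) (hc : 0 ≤ c) (hη : 0 < η) (hβ : 0 ≤ β) :
    ((n - R : ℕ) : ℝ) ≤ a + β / η * c +
      Real.exp (-(η * a)) / η * (Real.exp (-(β * c)) * (Real.exp (η * n) * Real.exp (-η) ^ R)) := by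
  have h1 : Real.exp (-(η * a)) / η * (Real.exp (-(β * c)) * (Real.exp (η * n) * Real.exp (-η) ^ R))
      = Real.exp (η * (n - R - a - β / η * c)) / η := by
    rw [← Real.exp_nat_mul, div_mul_eq_mul_div, ← Real.exp_add, ← Real.exp_add, ← Real.exp_add]
    congr 2
    field_simp
    ring
  rw [h1]
  have h2 : 0 ≤ β / η * c := by positivity
  rcases le_total n R with h | h
  · rw [Nat.sub_eq_zero_of_le h, Nat.cast_zero]
    positivity
  · rw [Nat.cast_sub h]
    have h3 := Real.add_one_le_exp (η * (n - R - a - β / η * c))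
    have h4 : (n - R - a - β / η * c : ℝ) ≤ Real.exp (η * (n - R - a - β / η * c)) / η := by
      rw [le_div_iff₀ hη]
      linarith
    linarith

/-- The expected number of jobs in `X` that exceeds the number of servers. -/
theorem mean_excess_le {η a G : ℝ} (hη : 0 < η) (ha : 0 ≤ a) (t : ℕ)
    (hG : ∑ s ∈ Finset.range t, M.hit cut X s M.root ≤ G) :
    mean M N lam mu A t (fun x => ((∑ i ∈ X, countState x.queue i - x.servers : ℕ) : ℝ≥0∞)) ≤
      ENNReal.ofReal a + ENNReal.ofReal ((Real.exp η - 1) / η) *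
        ev (historyLaw M N lam mu A t)
          (fun h => ENNReal.ofReal (histComp (M.hitFromCut cut X) 1 h)) +
      ENNReal.ofReal (Real.exp ((Real.exp η - 1) * (N * (lam * G)) +
        N * (mu * (Real.exp (-η) - 1)) - η * a) / η) := by
  set β := Real.exp η - 1 with hβ'
  have hβ : 0 ≤ β := by
    have := Real.add_one_le_exp η
    linarith
  set K := ENNReal.ofReal (Real.exp (-(η * a)) / η) with hK
  set E := fun h : List (Period S) =>
    ENNReal.ofReal (Real.exp (-(β * histComp (M.hitFromCut cut X) 1 h))) with hE
  have hc := fun h : List (Period S) =>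
    histComp_nonneg (fun s i => M.hitFromCut_nonneg cut X s i) 1 h
  have hpt : ∀ (h : List (Period S)) (x : Period S),
      ((∑ i ∈ X, countState x.queue i - x.servers : ℕ) : ℝ≥0∞) ≤
        ENNReal.ofReal a +
          ENNReal.ofReal (β / η) * ENNReal.ofReal (histComp (M.hitFromCut cut X) 1 h) +
        K * (E h * ((∏ j ∈ x.queue, potential M cut X β 0 j.state) *
          ENNReal.ofReal (Real.exp (-η)) ^ x.servers)) := by
    intro h x
    have := natSub_le_exp (∑ i ∈ X, countState x.queue i) x.servers ha (hc h) hη hβ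
    rw [← ENNReal.ofReal_natCast, hβ', prod_potential_zero, hK, hE,
      ← ENNReal.ofReal_pow (Real.exp_pos _).le]
    have h1 : 0 ≤ (Real.exp η - 1) / η := div_nonneg hβ hη.le
    have h2 := hc h
    rw [← ENNReal.ofReal_mul (by positivity), ← ENNReal.ofReal_mul (by positivity),
      ← ENNReal.ofReal_mul (by positivity),
      ← ENNReal.ofReal_add ha (by positivity), ← ENNReal.ofReal_mul (by positivity),
      ← ENNReal.ofReal_add (by positivity) (by positivity)]
    exact ENNReal.ofReal_le_ofReal this
  have hind : ∀ h, ev (nextPeriod M N lam mu A h) (fun x =>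
      (∏ j ∈ x.queue, potential M cut X β 0 j.state) * ENNReal.ofReal (Real.exp (-η)) ^ x.servers) =
      ev (nextPeriod M N lam mu A h) (fun x => ∏ j ∈ x.queue, potential M cut X β 0 j.state) *
        ev (bin N mu) fun R => ENNReal.ofReal (Real.exp (-η)) ^ R := by
    rintro (_ | ⟨x, h⟩)
    · rw [ev_nextPeriod_nil_mul M N lam mu A (fun Q => ∏ j ∈ Q, potential M cut X β 0 j.state)
          fun R => ENNReal.ofReal (Real.exp (-η)) ^ R,
        ev_nextPeriod_nil_queue M N lam mu A fun Q => ∏ j ∈ Q, potential M cut X β 0 j.state]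
    · rw [ev_nextPeriod_cons_mul M N lam mu A x h
          (fun Q => ∏ j ∈ Q, potential M cut X β 0 j.state)
          fun R => ENNReal.ofReal (Real.exp (-η)) ^ R,
        ev_nextPeriod_cons_queue M N lam mu A x h
          fun Q => ∏ j ∈ Q, potential M cut X β 0 j.state]
  refine (ev_mono fun h => ev_mono fun x => hpt h x).trans ?_
  simp only [ev_add, ev_const, ev_const_mul, hind]
  refine add_le_add_right ?_ _
  have h1 := ev_potential_le M (cut := cut) (X := X) N lam mu A hβ t 0
  have h2 := ev_bin_pow_le N mu (Real.exp_pos (-η)).le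
  simp only [← mul_assoc, ev_mul_const]
  simp only [mul_assoc]
  refine (mul_le_mul_right (mul_le_mul' h1 h2) K).trans ?_
  rw [hK, ← ENNReal.ofReal_mul (Real.exp_pos _).le, ← ENNReal.ofReal_mul (by positivity),
    div_mul_eq_mul_div, ← Real.exp_add, ← Real.exp_add]
  refine ENNReal.ofReal_le_ofReal (div_le_div_of_nonneg_right (Real.exp_le_exp.2 ?_) hη.le)
  simp only [zero_add]
  have h3 : β * (N * (lam * ∑ k ∈ Finset.range t, M.hit cut X k M.root)) ≤
      β * (N * (lam * G)) := by
    have := lam.2.1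
    gcongr
  linarith

theorem sum_ev_histComp_le {w : ℕ → S → ℝ} {r : S} (hw : ∀ s i, 0 ≤ w s i)
    (hr : ∀ s i, i ≠ r → w s i = 0) (T s : ℕ) :
    ∑ t ∈ Finset.range T,
      ev (historyLaw M N lam mu A t) (fun h => ENNReal.ofReal (histComp w s h)) ≤
      ENNReal.ofReal (∑ k ∈ Finset.range T, w (s + k) r) * totalRemaining M N lam mu A T r := by
  induction T generalizing s with
  | zero => simp
  | succ T ih =>
    rw [Finset.sum_range_succ', ev_historyLaw_zero, histComp, ENNReal.ofReal_zero, add_zero]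
    have h1 : ∀ t, ev (historyLaw M N lam mu A (t + 1)) (fun h => ENNReal.ofReal (histComp w s h)) =
        ENNReal.ofReal (w s r) *
          mean M N lam mu A t (fun x => (countState x.remaining r : ℝ≥0∞)) +
        ev (historyLaw M N lam mu A t) fun h => ENNReal.ofReal (histComp w (s + 1) h) := by
      intro t
      rw [ev_historyLaw_succ, mean, ← ev_const_mul, ← ev_add]
      congr 1
      ext h
      rw [← ev_const_mul]
      have h2 := ev_const (nextPeriod M N lam mu A h) (ENNReal.ofReal (histComp w (s + 1) h))
      refine Eq.trans ?_ (congrArg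
        (fun y => ev (nextPeriod M N lam mu A h) (fun x => ENNReal.ofReal (w s r) *
          (countState x.remaining r : ℝ≥0∞)) + y) h2)
      rw [← ev_add]
      congr 1
      ext x
      rw [histComp, ENNReal.ofReal_add (Finset.sum_nonneg fun j _ => hw _ _)
        (histComp_nonneg hw _ _), sum_job_eq, Finset.sum_eq_single r,
        ENNReal.ofReal_mul (hw _ _), ENNReal.ofReal_natCast]
      · intro i _ hi
        rw [hr _ _ hi, zero_mul]
      · simp
    simp only [h1, Finset.sum_add_distrib]
    rw [← Finset.mul_sum, Finset.sum_range_succ', add_zero,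
      ENNReal.ofReal_add (Finset.sum_nonneg fun k _ => hw _ _) (hw _ _), add_mul, add_comm]
    have hmono : totalRemaining M N lam mu A T r ≤ totalRemaining M N lam mu A (T + 1) r := by
      rw [totalRemaining, totalRemaining, Finset.sum_range_succ]
      exact le_self_add
    refine add_le_add ((ih (s + 1)).trans ?_) (mul_le_mul_right hmono _)
    simp only [add_right_comm s 1, ← add_assoc]
    exact mul_le_mul_right hmono _

end Exponential

/-! ### Service in order of priority -/

theorem countState_sdiff_add {S : Type*} [DecidableEq (Job S)] {X Q : Finset (Job S)} (h : X ⊆ Q) (i : S) :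
    countState (Q \ X) i + countState X i = countState Q i := by
  classical
  simp only [countState_eq_sum]
  convert Finset.sum_sdiff h

section Priority

variable {S : Type*} [Fintype S] {L : ℕ} (M : TreeChain S L)

variable {o : Fin (Fintype.card S) ≃ S}

open Classical in
theorem first_succ (k : Fin (Fintype.card S)) :
    TreeChain.first o (k + 1) = insert (o k) (TreeChain.first o k) := by
  ext i
  rw [Finset.mem_insert, TreeChain.first, TreeChain.first, Finset.mem_filter, Finset.mem_filter,
    Nat.lt_succ_iff, le_iff_eq_or_lt, ← Equiv.symm_apply_eq, Fin.ext_iff]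
  simp

theorem sum_Iio_eq_sum_first (k : Fin (Fintype.card S)) (c : S → ℕ) :
    ∑ l ∈ Finset.Iio k, c (o l) = ∑ i ∈ TreeChain.first o k, c i := by
  classical
  refine Finset.sum_equiv o (fun l => ?_) fun l _ => rfl
  simp [TreeChain.first]

/-- Under a priority policy the servers work on the states of highest priority. -/
theorem sum_first_eq_min {X Q : Finset (Job S)} {R : ℕ}
    (h : ∀ i : S, countState X i =
      min (countState Q i) (R - ∑ k ∈ Finset.Iio (o.symm i), countState Q (o k)))
    {m : ℕ} (hm : m ≤ Fintype.card S) :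
    ∑ i ∈ TreeChain.first o m, countState X i =
      min (∑ i ∈ TreeChain.first o m, countState Q i) R := by
  classical
  induction m with
  | zero => simp [TreeChain.first]
  | succ m ih =>
    have hk : o ⟨m, hm⟩ ∉ TreeChain.first o m := by simp [TreeChain.first]
    rw [first_succ ⟨m, hm⟩, Finset.sum_insert hk, Finset.sum_insert hk, ih (by omega), h,
      Equiv.symm_apply_apply, sum_Iio_eq_sum_first]
    dsimp only
    omega

variable {N : ℕ} {lam mu : unitInterval} {A : Policy S}

theorem exists_served_mem_support {h : List (Period S)} {x : Period S}
    (hx : x ∈ (nextPeriod M N lam mu A h).support) :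
    ∃ h', x.served ∈ (A h' x.queue x.servers).support := by
  have key : ∀ h Q, x ∈ (serve N mu A h Q).support → x.served ∈ (A h x.queue x.servers).support := by
    intro h Q hx
    simp only [serve, PMF.mem_support_bind_iff, PMF.mem_support_map_iff] at hx
    obtain ⟨R, -, X, hX, rfl⟩ := hx
    exact hX
  cases h with
  | nil => exact ⟨_, key _ _ hx⟩
  | cons y h =>
    simp only [nextPeriod, PMF.mem_support_bind_iff] at hx
    obtain ⟨f, -, a, -, hx⟩ := hx
    exact ⟨_, key _ _ hx⟩

theorem sum_first_remaining_le (hA : A.IsPrio o) {h : List (Period S)} {x : Period S}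
    (hx : x ∈ (nextPeriod M N lam mu A h).support) {m : ℕ} (hm : m ≤ Fintype.card S) :
    ∑ i ∈ TreeChain.first o m, countState x.remaining i ≤
      ∑ i ∈ TreeChain.first o m, countState x.queue i - x.servers := by
  classical
  obtain ⟨h', hs⟩ := exists_served_mem_support M hx
  have h1 := sum_first_eq_min (hA.2 _ _ _ _ hs) hm
  have h2 : ∑ i ∈ TreeChain.first o m, countState x.remaining i +
      ∑ i ∈ TreeChain.first o m, countState x.served i =
      ∑ i ∈ TreeChain.first o m, countState x.queue i := by
    rw [← Finset.sum_add_distrib]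
    exact Finset.sum_congr rfl fun i _ => countState_sdiff_add (hA.1 _ _ _ _ hs).1 i
  omega

variable (N lam mu)

/-- The jobs that remain in `W` either exceed the number of servers among the jobs in `V`, or are
in `W` but not in `V`. -/
theorem sum_totalRemaining_le [DecidableEq S] (hA : A.IsPrio o) {V W : Finset S} {m : ℕ}
    (hm : m ≤ Fintype.card S) (hV : V ⊆ TreeChain.first o m) (hW : TreeChain.first o m ⊆ W)
    (T : ℕ) :
    ∑ i ∈ W, totalRemaining M N lam mu A T i ≤
      ∑ t ∈ Finset.range T, mean M N lam mu A t
        (fun x => ((∑ i ∈ V, countState x.queue i - x.servers : ℕ) : ℝ≥0∞)) +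
      ∑ i ∈ W \ V, totalQueue M N lam mu A T i := by
  have hpt : ∀ h, ∀ x ∈ (nextPeriod M N lam mu A h).support,
      ∑ i ∈ W, (countState x.remaining i : ℝ≥0∞) ≤
        ((∑ i ∈ V, countState x.queue i - x.servers : ℕ) : ℝ≥0∞) +
          ∑ i ∈ W \ V, (countState x.queue i : ℝ≥0∞) := by
    intro h x hx
    have h1 := sum_first_remaining_le M hA hx hm
    have h2 := Finset.sum_sdiff (f := fun i => countState x.remaining i) hW
    have h3 := Finset.sum_sdiff (f := fun i => countState x.queue i) hW
    have h4 := Finset.sum_sdiff (f := fun i => countState x.queue i) (hV.trans hW)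
    have h5 := Finset.sum_sdiff (f := fun i => countState x.queue i) hV
    have h6 : ∑ i ∈ W \ TreeChain.first o m, countState x.remaining i ≤
        ∑ i ∈ W \ TreeChain.first o m, countState x.queue i :=
      Finset.sum_le_sum fun i _ => countState_mono (remaining_subset x) i
    have h7 : ∑ i ∈ W, countState x.remaining i ≤
        (∑ i ∈ V, countState x.queue i - x.servers) + ∑ i ∈ W \ V, countState x.queue i := by
      omega
    exact_mod_cast h7
  simp only [totalRemaining, totalQueue]
  rw [Finset.sum_comm, Finset.sum_comm (s := W \ V), ← Finset.sum_add_distrib]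
  refine Finset.sum_le_sum fun t _ => ?_
  rw [← mean_finset_sum, ← mean_finset_sum, ← mean_add]
  exact ev_mono fun h => ev_mono_of_support (hpt h)

end Priority

/-! ### Expected numbers of jobs as real numbers -/

section Totals

variable {S : Type*} [Fintype S] {L : ℕ} (M : TreeChain S L)
variable (N : ℕ) (lam mu : unitInterval) (A : Policy S) (T : ℕ)

theorem totalQueue_le (i : S) :
    totalQueue M N lam mu A T i ≤ ENNReal.ofReal (T * (N * (lam * M.pi i))) := by
  have hlam := lam.2.1
  refine M.parent_induction (C := fun i => totalQueue M N lam mu A T i ≤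
    ENNReal.ofReal (T * (N * (lam * M.pi i)))) ?_ (fun i k hk ih => ?_) i
  · refine (totalQueue_root_le M N lam mu A T).trans_eq ?_
    rw [M.pi_root, mul_one, ENNReal.ofReal_mul (Nat.cast_nonneg T), ENNReal.ofReal_natCast]
  · refine (totalQueue_child_le M N lam mu A T hk).trans ?_
    refine (mul_le_mul_right ((totalRemaining_le_totalQueue M N lam mu A T i).trans ih) _).trans ?_
    rw [← ENNReal.ofReal_mul (M.P_nonneg i k), M.pi_child hk]
    exact ENNReal.ofReal_le_ofReal (le_of_eq (by ring))

theorem totalQueue_ne_top (i : S) : totalQueue M N lam mu A T i ≠ ∞ :=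
  ne_top_of_le_ne_top ENNReal.ofReal_ne_top (totalQueue_le M N lam mu A T i)

theorem totalRemaining_ne_top (i : S) : totalRemaining M N lam mu A T i ≠ ∞ :=
  ne_top_of_le_ne_top (totalQueue_ne_top M N lam mu A T i)
    (totalRemaining_le_totalQueue M N lam mu A T i)

theorem toReal_totalRemaining_le (i : S) :
    (totalRemaining M N lam mu A T i).toReal ≤ T * (N * (lam * M.pi i)) := by
  have h0 : (0 : ℝ) ≤ T * (N * (lam * M.pi i)) := by
    have := lam.2.1
    have := (M.pi_pos i).le
    positivity
  exact ENNReal.toReal_le_of_le_ofReal h0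
    ((totalRemaining_le_totalQueue M N lam mu A T i).trans (totalQueue_le M N lam mu A T i))

theorem toReal_totalQueue_child_le {i k : S} (hk : M.parent k = some i) :
    (totalQueue M N lam mu A T k).toReal ≤
      M.P i k * (totalRemaining M N lam mu A T i).toReal := by
  have h := ENNReal.toReal_mono (ENNReal.mul_ne_top ENNReal.ofReal_ne_top
    (totalRemaining_ne_top M N lam mu A T i)) (totalQueue_child_le M N lam mu A T hk)
  rwa [ENNReal.toReal_mul, ENNReal.toReal_ofReal (M.P_nonneg i k)] at h

theorem toReal_totalRemaining_le_mul_of_isAnc {r i : S} (h : M.IsAnc r i) :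
    (totalRemaining M N lam mu A T i).toReal ≤
      (totalRemaining M N lam mu A T r).toReal * (M.pi i / M.pi r) := by
  induction h with
  | refl => rw [div_self (M.pi_pos r).ne', mul_one]
  | @tail i k _ hk ih =>
    have h1 := ENNReal.toReal_mono (totalQueue_ne_top M N lam mu A T k)
      (totalRemaining_le_totalQueue M N lam mu A T k)
    have h2 := toReal_totalQueue_child_le M N lam mu A T hk
    have h3 := mul_le_mul_of_nonneg_left ih (M.P_nonneg i k)
    refine (h1.trans (h2.trans h3)).trans_eq ?_
    rw [M.pi_child hk]
    ring

theorem sum_toReal_totalQueue_le [DecidableEq S] (B : Finset S) :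
    ∑ i ∈ M.subSet B \ M.top B, (totalQueue M N lam mu A T i).toReal ≤
      (1 - M.theta) * ∑ i ∈ M.subSet B, (totalRemaining M N lam mu A T i).toReal := by
  have hsub : M.subSet B \ M.top B ⊆ (M.subSet B).biUnion M.child := by
    intro k hk
    rw [Finset.mem_sdiff] at hk
    obtain ⟨t, ht, htk⟩ := M.exists_top_isAnc hk.1
    rcases Relation.ReflTransGen.cases_tail htk with h | ⟨i, hti, hik⟩
    · exact absurd (h ▸ ht) hk.2
    · exact Finset.mem_biUnion.2
        ⟨i, M.mem_subSet.2 ⟨t, M.top_subset _ ht, hti⟩, M.mem_child.2 hik⟩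
  calc _ ≤ ∑ k ∈ (M.subSet B).biUnion M.child, (totalQueue M N lam mu A T k).toReal :=
        Finset.sum_le_sum_of_subset_of_nonneg hsub fun _ _ _ => ENNReal.toReal_nonneg
    _ ≤ ∑ i ∈ M.subSet B, ∑ k ∈ M.child i, (totalQueue M N lam mu A T k).toReal :=
        sum_biUnion_le_of_nonneg _ _ _ fun _ => ENNReal.toReal_nonneg
    _ ≤ _ := by
        rw [Finset.mul_sum]
        refine Finset.sum_le_sum fun i _ => ?_
        refine (Finset.sum_le_sum fun k hk =>
          toReal_totalQueue_child_le M N lam mu A T (M.mem_child.1 hk)).trans ?_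
        rw [← Finset.sum_mul]
        exact mul_le_mul_of_nonneg_right (M.sum_child_P_le i) ENNReal.toReal_nonneg

end Totals

/-! ### Bounds for a priority policy -/

section Bounds

theorem exponent_le {n η l m a : ℝ} (hη0 : 0 < η) (hη1 : η ≤ 1) (hn : n * η ^ 2 = 1)
    (hn0 : 0 ≤ n) (hl0 : 0 ≤ l) (hl2 : l ≤ 2) (hm0 : 0 ≤ m) (hm1 : m ≤ 1) (ha : n * (l - m) ≤ a) :
    (Real.exp η - 1) * (n * l) + n * (m * (Real.exp (-η) - 1)) - η * a ≤ 3 := by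
  have h1 := (abs_le.1 (Real.abs_exp_sub_one_sub_id_le (x := η) (by rwa [abs_of_pos hη0]))).2
  have h2 := (abs_le.1 (Real.abs_exp_sub_one_sub_id_le (x := -η)
    (by rwa [abs_neg, abs_of_pos hη0]))).2
  have h3 := mul_le_mul_of_nonneg_left h1 (mul_nonneg hn0 hl0)
  have h4 := mul_le_mul_of_nonneg_left h2 (mul_nonneg hn0 hm0)
  have h5 := mul_le_mul_of_nonneg_left ha hη0.le
  have h6 : n * l * η ^ 2 = l := by linear_combination l * hn
  have h7 : n * m * (-η) ^ 2 = m := by linear_combination m * hn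
  rw [h6] at h3
  rw [h7] at h4
  linarith

variable {S : Type*} [Fintype S] {L : ℕ} (M : TreeChain S L)
variable {N : ℕ} (hN : 1 ≤ N) (lam mu : unitInterval) (A : Policy S) (T : ℕ)

include hN in
theorem sum_mean_excess_le (cut : Option S) {X : Finset S} {a G : ℝ} (ha0 : 0 ≤ a)
    (hG0 : 0 ≤ G) (hG : ∀ t, ∑ s ∈ Finset.range t, M.hit cut X s M.root ≤ G) (hG2 : (lam : ℝ) * G ≤ 2)
    (ha : (N : ℝ) * ((lam : ℝ) * G - mu) ≤ a) :
    ∑ t ∈ Finset.range T, mean M N lam mu A t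
      (fun x => ((∑ i ∈ X, countState x.queue i - x.servers : ℕ) : ℝ≥0∞)) ≤
      ENNReal.ofReal (T * (a + Real.exp 3 * Real.sqrt N)) +
      ENNReal.ofReal (1 + 1 / Real.sqrt N) * ∑ t ∈ Finset.range T,
        ev (historyLaw M N lam mu A t)
          (fun h => ENNReal.ofReal (histComp (M.hitFromCut cut X) 1 h)) := by
  have hN' : (1 : ℝ) ≤ N := by exact_mod_cast hN
  have hs : 1 ≤ Real.sqrt N := Real.one_le_sqrt.2 hN'
  set η := 1 / Real.sqrt N with hη
  have hη0 : 0 < η := by positivity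
  have hη1 : η ≤ 1 := by
    rw [hη, div_le_one (by positivity)]
    exact hs
  have hNη : N * η ^ 2 = 1 := by
    rw [hη, div_pow, Real.sq_sqrt (by positivity)]
    field_simp
  have h1 := (abs_le.1 (Real.abs_exp_sub_one_sub_id_le (x := η) (by rwa [abs_of_pos hη0]))).2
  have hβ : (Real.exp η - 1) / η ≤ 1 + η := by
    rw [div_le_iff₀ hη0]
    linarith
  have hexp := exponent_le hη0 hη1 hNη (by positivity) (mul_nonneg lam.2.1 hG0) hG2 mu.2.1 mu.2.2 ha
  have hK : ∀ y, y ≤ 3 → Real.exp y / η ≤ Real.exp 3 * Real.sqrt N := by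
    intro y hy
    rw [hη, div_div_eq_mul_div, div_one]
    exact mul_le_mul_of_nonneg_right (Real.exp_le_exp.2 hy) (by positivity)
  have hpt : ∀ t, mean M N lam mu A t
      (fun x => ((∑ i ∈ X, countState x.queue i - x.servers : ℕ) : ℝ≥0∞)) ≤
      ENNReal.ofReal (a + Real.exp 3 * Real.sqrt N) + ENNReal.ofReal (1 + η) *
        ev (historyLaw M N lam mu A t)
          (fun h => ENNReal.ofReal (histComp (M.hitFromCut cut X) 1 h)) := by
    intro t
    refine (mean_excess_le M N lam mu A hη0 ha0 t (hG t)).trans ?_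
    rw [ENNReal.ofReal_add ha0 (by positivity), add_right_comm]
    gcongr
    exact hK _ hexp
  refine (Finset.sum_le_sum fun t _ => hpt t).trans_eq ?_
  rw [Finset.sum_add_distrib, ← Finset.mul_sum, Finset.sum_const, Finset.card_range, nsmul_eq_mul,
    ENNReal.ofReal_mul (Nat.cast_nonneg T), ENNReal.ofReal_natCast]

variable {o : Fin (Fintype.card S) ≃ S} {A}

include hN in
/-- The fully served states and their descendants are almost empty. -/
theorem theta_mul_sum_subSet_le (hA : A.IsPrio o) :
    M.theta * ∑ i ∈ M.subSet (M.served lam mu o), (totalRemaining M N lam mu A T i).toReal ≤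
      T * (Real.exp 3 * Real.sqrt N) := by
  classical
  set B := M.served lam mu o with hB
  have hload : lam * ∑ i ∈ M.top B, M.pi i ≤ mu := by
    have := M.load_cut_le lam mu o mu.2.1
    rwa [TreeChain.load, ← Finset.mul_sum] at this
  have h1 := sum_totalRemaining_le M N lam mu hA (V := M.top B) (W := M.subSet B)
    (Nat.findGreatest_le _) (M.top_subset B) (M.subset_subSet B) T
  have h2 := sum_mean_excess_le M hN lam mu A T none (X := M.top B) (a := 0) le_rfl
    (Finset.sum_nonneg fun i _ => (M.pi_pos i).le) (M.sum_hit_root_none_le)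
    (by linarith [mu.2.2]) (mul_nonpos_of_nonneg_of_nonpos (by positivity) (by linarith))
  simp only [histComp_eq_zero (M.hitFromCut_none _), ENNReal.ofReal_zero, ev_const,
    Finset.sum_const_zero, mul_zero, add_zero, zero_add] at h2
  have h3 := h1.trans (add_le_add_left h2 _)
  have hq : ∑ i ∈ M.subSet B \ M.top B, totalQueue M N lam mu A T i ≠ ∞ :=
    ENNReal.sum_ne_top.2 fun i _ => totalQueue_ne_top M N lam mu A T i
  have h4 := ENNReal.toReal_mono (ENNReal.add_ne_top.2 ⟨ENNReal.ofReal_ne_top, hq⟩) h3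
  rw [ENNReal.toReal_add ENNReal.ofReal_ne_top hq, ENNReal.toReal_ofReal (by positivity),
    ENNReal.toReal_sum fun i _ => totalQueue_ne_top M N lam mu A T i,
    ENNReal.toReal_sum fun i _ => totalRemaining_ne_top M N lam mu A T i] at h4
  have h5 := sum_toReal_totalQueue_le M N lam mu A T B
  linarith

include hN in
/-- The number of remaining jobs in the partially-served state is close to its equilibrium value. -/
theorem kappa_mul_totalRemaining_le (hθ : 0 < M.theta) (hA : A.IsPrio o) {r : S}
    (hr : M.partialNode lam mu o = some r) :
    M.kappa lam mu o r * (totalRemaining M N lam mu A T r).toReal ≤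
      T * (N * (M.kappa lam mu o r * (lam * M.pi r - M.nuPartial lam mu o r)) +
        (Real.exp 3 + 1) * Real.sqrt N) := by
  classical
  set B := M.served lam mu o with hB
  set κ := M.kappa lam mu o r with hκ
  have hmu := mu.2.1
  have hlam := lam.2.1
  have hrB := M.partialNode_notMem_subSet hmu hr
  have hrT : r ∉ M.top B := fun h => hrB (M.subset_subSet _ (M.top_subset _ h))
  have hκ0 : 0 < κ := hθ.trans_le (M.theta_le_kappa hmu hθ.le hr)
  have hκ1 : κ ≤ 1 := sub_le_self _ (Finset.sum_nonneg fun i _ =>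
    div_nonneg (M.pi_pos i).le (M.pi_pos r).le)
  have hload : lam * ∑ i ∈ M.top B, M.pi i ≤ mu := by
    have := M.load_cut_le lam mu o mu.2.1
    rwa [TreeChain.load, ← Finset.mul_sum] at this
  have hlt := M.lt_lam_mul hmu hr
  have hpi := M.pi_mul_kappa (lam := lam) (mu := mu) (o := o) r
  rw [← hB, ← hκ] at hpi hlt
  have hXr : ∑ x ∈ insert r (M.top B) ∩ M.sub r, M.pi x - M.pi r = M.pi r * (1 - κ) := by
    rw [Finset.insert_inter_of_mem (M.mem_sub.2 (M.isAnc_refl r)), Finset.sum_insert]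
    · linarith
    · exact fun h => hrT (Finset.mem_inter.1 h).1
  have hG : ∀ t, ∑ s ∈ Finset.range t, M.hit (some r) (insert r (M.top B)) s M.root ≤
      ∑ i ∈ M.top B, M.pi i + M.pi r * κ := by
    intro t
    refine (M.sum_hit_root_some_le (Finset.mem_insert_self _ _) t).trans_eq ?_
    rw [hXr, Finset.sum_insert hrT]
    ring
  have hW : ∀ n, ∑ s ∈ Finset.range n,
      M.hitFromCut (some r) (insert r (M.top B)) (1 + s) r ≤ 1 - κ := by
    intro n
    refine le_of_mul_le_mul_left ?_ (M.pi_pos r)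
    rw [← hXr]
    simp only [add_comm 1]
    exact M.pi_mul_sum_hitFromCut_le (Finset.mem_insert_self _ _) n
  have hpκ : lam * (M.pi r * κ) ≤ 1 :=
    mul_le_one₀ lam.2.2 (mul_nonneg (M.pi_pos r).le hκ0.le)
      (mul_le_one₀ (M.pi_le_one r) hκ0.le hκ1)
  set a := (N : ℝ) * ((lam : ℝ) * (∑ i ∈ M.top B, M.pi i + M.pi r * κ) - mu) with ha
  have ha0 : 0 ≤ a := mul_nonneg (Nat.cast_nonneg N) (by linarith)
  have hfirst : TreeChain.first o (M.cut lam mu o + 1) = insert r B := by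
    ext i
    rw [M.mem_first_succ_cut hr, Finset.mem_insert]
  have h1 := sum_totalRemaining_le M N lam mu hA (V := insert r (M.top B))
    (W := insert r (M.subSet B)) (m := M.cut lam mu o + 1) (M.partialNode_spec hr).1
    (by rw [hfirst]; exact Finset.insert_subset_insert _ (M.top_subset B))
    (by rw [hfirst]; exact Finset.insert_subset_insert _ (M.subset_subSet B)) T
  have h2 := sum_mean_excess_le M hN lam mu A T (some r) (X := insert r (M.top B)) (a := a) ha0
    (add_nonneg (Finset.sum_nonneg fun i _ => (M.pi_pos i).le)
      (mul_nonneg (M.pi_pos r).le hκ0.le)) hG (by linarith [mu.2.2]) le_rfl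
  have h3 := sum_ev_histComp_le M N lam mu A (r := r)
    (fun s i => M.hitFromCut_nonneg (some r) (insert r (M.top B)) s i)
    (fun s i hi => M.hitFromCut_of_ne _ hi s) T 1
  have h4 := h3.trans (mul_le_mul_left (ENNReal.ofReal_le_ofReal (hW T)) _)
  have h5 := h1.trans (add_le_add_left (h2.trans (add_le_add_right (mul_le_mul_right h4 _) _)) _)
  have hdiff : insert r (M.subSet B) \ insert r (M.top B) = M.subSet B \ M.top B := by
    ext i
    simp only [Finset.mem_sdiff, Finset.mem_insert]
    constructor
    · tauto
    · rintro ⟨h, h'⟩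
      refine ⟨Or.inr h, ?_⟩
      rintro (rfl | h'')
      · exact hrB h
      · exact h' h''
  rw [hdiff, Finset.sum_insert hrB] at h5
  have hq : ∑ i ∈ M.subSet B \ M.top B, totalQueue M N lam mu A T i ≠ ∞ :=
    ENNReal.sum_ne_top.2 fun i _ => totalQueue_ne_top M N lam mu A T i
  have hz : ∑ i ∈ M.subSet B, totalRemaining M N lam mu A T i ≠ ∞ :=
    ENNReal.sum_ne_top.2 fun i _ => totalRemaining_ne_top M N lam mu A T i
  have hzr := totalRemaining_ne_top M N lam mu A T r
  have hc : ENNReal.ofReal (1 + 1 / Real.sqrt N) *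
      (ENNReal.ofReal (1 - κ) * totalRemaining M N lam mu A T r) ≠ ∞ :=
    ENNReal.mul_ne_top ENNReal.ofReal_ne_top (ENNReal.mul_ne_top ENNReal.ofReal_ne_top hzr)
  have hadd := ENNReal.add_ne_top.2 ⟨ENNReal.ofReal_ne_top
    (r := T * (a + Real.exp 3 * Real.sqrt N)), hc⟩
  have h6 := ENNReal.toReal_mono (ENNReal.add_ne_top.2 ⟨hadd, hq⟩) h5
  rw [ENNReal.toReal_add hadd hq, ENNReal.toReal_add ENNReal.ofReal_ne_top hc,
    ENNReal.toReal_add hzr hz, ENNReal.toReal_mul, ENNReal.toReal_mul,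
    ENNReal.toReal_ofReal (by positivity), ENNReal.toReal_ofReal (by positivity),
    ENNReal.toReal_ofReal (by linarith),
    ENNReal.toReal_sum fun i _ => totalQueue_ne_top M N lam mu A T i,
    ENNReal.toReal_sum fun i _ => totalRemaining_ne_top M N lam mu A T i] at h6
  have h7 := sum_toReal_totalQueue_le M N lam mu A T B
  have h8 : 0 ≤ M.theta * ∑ i ∈ M.subSet B, (totalRemaining M N lam mu A T i).toReal :=
    mul_nonneg hθ.le (Finset.sum_nonneg fun _ _ => ENNReal.toReal_nonneg)
  have hN' : (1 : ℝ) ≤ N := by exact_mod_cast hN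
  have hs : 1 ≤ Real.sqrt N := Real.one_le_sqrt.2 hN'
  have h9 : 1 / Real.sqrt N * ((1 - κ) * (totalRemaining M N lam mu A T r).toReal) ≤
      T * Real.sqrt N := by
    have hle : (totalRemaining M N lam mu A T r).toReal ≤ T * N := by
      refine (toReal_totalRemaining_le M N lam mu A T r).trans ?_
      have := mul_le_one₀ lam.2.2 (M.pi_pos r).le (M.pi_le_one r)
      have h : (N : ℝ) * (lam * M.pi r) ≤ N := mul_le_of_le_one_right (by positivity) this
      exact mul_le_mul_of_nonneg_left h (by positivity)
    have hle' : (1 - κ) * (totalRemaining M N lam mu A T r).toReal ≤ T * N :=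
      (mul_le_of_le_one_left ENNReal.toReal_nonneg (by linarith)).trans hle
    refine (mul_le_mul_of_nonneg_left hle' (by positivity)).trans_eq ?_
    have : (N : ℝ) = Real.sqrt N * Real.sqrt N := (Real.mul_self_sqrt (by positivity)).symm
    nth_rewrite 2 [this]
    field_simp
  have hν : M.nuPartial lam mu o r * κ = mu - lam * ∑ i ∈ M.top B, M.pi i := by
    rw [TreeChain.nuPartial, ← hκ, ← hB, div_mul_cancel₀ _ hκ0.ne']
  have ha' : a = N * (κ * (lam * M.pi r - M.nuPartial lam mu o r)) := by
    rw [ha]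
    linear_combination (N : ℝ) * hν
  rw [← ha']
  linarith

end Bounds

/-! ### The fluid equilibrium and the cost -/

section Cost

variable {S : Type*} [Fintype S] {L : ℕ} (M : TreeChain S L)
variable (lam mu : ℝ) (o : Fin (Fintype.card S) ≃ S)

theorem qEq_sub_nuEq_of_mem {i : S} (hi : i ∈ M.subSet (M.served lam mu o)) :
    M.qEq lam mu o i - M.nuEq lam mu o i = 0 := by
  unfold TreeChain.qEq TreeChain.nuEq
  simp only [if_pos hi]
  split <;> simp

theorem qEq_sub_nuEq_of_notMem {i : S} (hi : i ∉ M.subSet (M.served lam mu o)) :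
    M.qEq lam mu o i - M.nuEq lam mu o i = M.inflow lam mu o i -
      (open Classical in if M.partialNode lam mu o = some i then M.nuPartial lam mu o i else 0) := by
  have : i ∉ M.top (M.served lam mu o) := fun h => hi (M.subset_subSet _ (M.top_subset _ h))
  simp [TreeChain.qEq, TreeChain.nuEq, hi, this]

theorem qEq_sub_nuEq_of_partialNode_eq_none {i : S} (hi : i ∉ M.subSet (M.served lam mu o))
    (h : M.partialNode lam mu o = none) :
    M.qEq lam mu o i - M.nuEq lam mu o i = lam * M.pi i := by
  rw [qEq_sub_nuEq_of_notMem M lam mu o hi, TreeChain.inflow]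
  simp [h]

theorem qEq_sub_nuEq_of_notMem_sub {i r : S} (hi : i ∉ M.subSet (M.served lam mu o))
    (h : M.partialNode lam mu o = some r) (hir : i ∉ M.sub r) :
    M.qEq lam mu o i - M.nuEq lam mu o i = lam * M.pi i := by
  have hne : r ≠ i := by
    rintro rfl
    exact hir (M.mem_sub.2 (M.isAnc_refl r))
  rw [qEq_sub_nuEq_of_notMem M lam mu o hi, TreeChain.inflow]
  simp [h, hir, hne]

theorem qEq_sub_nuEq_of_mem_sub {i r : S} (hi : i ∉ M.subSet (M.served lam mu o))
    (h : M.partialNode lam mu o = some r) (hir : i ∈ M.sub r) :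
    M.qEq lam mu o i - M.nuEq lam mu o i =
      (lam * M.pi r - M.nuPartial lam mu o r) * (M.pi i / M.pi r) := by
  have hpos := (M.pi_pos r).ne'
  rw [qEq_sub_nuEq_of_notMem M lam mu o hi, TreeChain.inflow]
  by_cases hne : i = r
  · subst hne
    simp [h, hpos]
  · have hne' : r ≠ i := fun h => hne h.symm
    simp only [h, hir, hne, ne_eq, not_false_eq_true, and_self, if_true, Option.some.injEq, hne',
      if_false, sub_zero]
    field_simp

end Cost

section Main

variable {S : Type*} [Fintype S] {L : ℕ} (M : TreeChain S L)
variable {N : ℕ} (hN : 1 ≤ N) (lam mu : unitInterval) {A : Policy S} (T : ℕ)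
variable {o : Fin (Fintype.card S) ≃ S}

theorem cmax_pos : 0 < M.cmax := (M.cost_pos M.root).trans_le (M.cost_le_cmax M.root)

include hN in
/-- The cost outside of the fully served states and their descendants. -/
theorem cost_mul_totalRemaining_le (hθ : 0 < M.theta) (hA : A.IsPrio o) {i : S}
    (hi : i ∉ M.subSet (M.served lam mu o)) :
    M.cost i * (totalRemaining M N lam mu A T i).toReal ≤
      T * (N * (M.cost i * (M.qEq lam mu o i - M.nuEq lam mu o i))) +
      (match M.partialNode lam mu o with
        | none => 0
        | some r => open Classical in if i ∈ M.sub r then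
            T * (M.cmax * ((Real.exp 3 + 1) * Real.sqrt N / M.theta)) * (M.pi i / M.pi r)
          else 0) := by
  have hci := (M.cost_pos i).le
  have hz := toReal_totalRemaining_le M N lam mu A T i
  have hgen : M.cost i * (totalRemaining M N lam mu A T i).toReal ≤
      T * (N * (M.cost i * (lam * M.pi i))) + 0 :=
    (mul_le_mul_of_nonneg_left hz hci).trans_eq (by ring)
  cases hp : M.partialNode lam mu o with
  | none =>
    rw [qEq_sub_nuEq_of_partialNode_eq_none M _ _ _ hi hp]
    exact hgen
  | some r =>
    dsimp only
    split
    · rename_i hir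
      rw [qEq_sub_nuEq_of_mem_sub M _ _ _ hi hp hir]
      have hκ := M.theta_le_kappa mu.2.1 hθ.le hp
      have hκ0 := hθ.trans_le hκ
      have h1 := kappa_mul_totalRemaining_le M hN lam mu T hθ hA hp
      set κ := M.kappa lam mu o r
      set d := lam * M.pi r - M.nuPartial lam mu o r
      set z := (totalRemaining M N lam mu A T r).toReal
      have h2 : z ≤ T * (N * d + (Real.exp 3 + 1) * Real.sqrt N / M.theta) := by
        have h3 : (Real.exp 3 + 1) * Real.sqrt N ≤
            κ * ((Real.exp 3 + 1) * Real.sqrt N / M.theta) := by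
          rw [mul_div_assoc', le_div_iff₀ hθ, mul_comm κ]
          exact mul_le_mul_of_nonneg_left hκ (by positivity)
        refine le_of_mul_le_mul_left (h1.trans ?_) hκ0
        have := mul_le_mul_of_nonneg_left h3 (Nat.cast_nonneg (α := ℝ) T)
        linarith
      have h4 := toReal_totalRemaining_le_mul_of_isAnc M N lam mu A T (M.mem_sub.1 hir)
      have hpi : 0 ≤ M.pi i / M.pi r := div_nonneg (M.pi_pos i).le (M.pi_pos r).le
      have h5 := h4.trans (mul_le_mul_of_nonneg_right h2 hpi)
      have h6 := mul_le_mul_of_nonneg_left h5 hci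
      have h7 : M.cost i * (T * ((Real.exp 3 + 1) * Real.sqrt N / M.theta) * (M.pi i / M.pi r)) ≤
          M.cmax * (T * ((Real.exp 3 + 1) * Real.sqrt N / M.theta) * (M.pi i / M.pi r)) :=
        mul_le_mul_of_nonneg_right (M.cost_le_cmax i) (by positivity)
      linarith
    · rename_i hir
      rw [qEq_sub_nuEq_of_notMem_sub M _ _ _ hi hp hir]
      exact hgen

include hN in
theorem sum_cost_mul_totalRemaining_le (hθ : 0 < M.theta) (hA : A.IsPrio o) :
    ∑ i, M.cost i * (totalRemaining M N lam mu A T i).toReal ≤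
      T * (N * M.fluidCost lam mu o +
        M.cmax * ((2 * Real.exp 3 + 1) * (M.theta ^ 2)⁻¹ * Real.sqrt N)) := by
  classical
  set B := M.served lam mu o with hB
  set K := (Real.exp 3 + 1) * Real.sqrt N / M.theta with hK
  have hcm := cmax_pos M
  have hsub : ∑ i ∈ M.subSet B, M.cost i * (totalRemaining M N lam mu A T i).toReal ≤
      M.cmax * (T * (Real.exp 3 * Real.sqrt N) / M.theta) := by
    have h1 := theta_mul_sum_subSet_le M hN lam mu T hA
    calc _ ≤ M.cmax * ∑ i ∈ M.subSet B, (totalRemaining M N lam mu A T i).toReal := by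
          rw [Finset.mul_sum]
          exact Finset.sum_le_sum fun i _ =>
            mul_le_mul_of_nonneg_right (M.cost_le_cmax i) ENNReal.toReal_nonneg
      _ ≤ _ := by
          refine mul_le_mul_of_nonneg_left ?_ hcm.le
          rwa [le_div_iff₀ hθ, mul_comm]
  have hcompl : ∑ i ∈ (M.subSet B)ᶜ, M.cost i * (totalRemaining M N lam mu A T i).toReal ≤
      T * (N * M.fluidCost lam mu o) + T * (M.cmax * K) / M.theta := by
    refine (Finset.sum_le_sum fun i hi => cost_mul_totalRemaining_le M hN lam mu T hθ hA
      (Finset.mem_compl.1 hi)).trans ?_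
    rw [Finset.sum_add_distrib]
    refine add_le_add (le_of_eq ?_) ?_
    · rw [← Finset.mul_sum, ← Finset.mul_sum, TreeChain.fluidCost,
        ← Finset.sum_compl_add_sum (M.subSet B)]
      congr 2
      refine (add_eq_left.2 (Finset.sum_eq_zero fun i hi => ?_)).symm
      rw [qEq_sub_nuEq_of_mem M _ _ _ hi, mul_zero]
    · cases hp : M.partialNode lam mu o with
      | none =>
        simp only [Finset.sum_const_zero]
        positivity
      | some r =>
        dsimp only
        have hpr := M.pi_pos r
        have h2 : ∑ i ∈ M.sub r, M.pi i / M.pi r ≤ 1 / M.theta := by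
          rw [← Finset.sum_div, div_le_div_iff₀ hpr hθ, one_mul, mul_comm]
          exact M.theta_mul_sum_sub_pi_le r
        have hnn : 0 ≤ T * (M.cmax * K) := by positivity
        calc _ ≤ ∑ i, if i ∈ M.sub r then T * (M.cmax * K) * (M.pi i / M.pi r) else 0 :=
              Finset.sum_le_sum_of_subset_of_nonneg (Finset.subset_univ _) fun i _ _ => by
                split
                · exact mul_nonneg hnn (div_nonneg (M.pi_pos i).le hpr.le)
                · exact le_rfl
          _ = T * (M.cmax * K) * ∑ i ∈ M.sub r, M.pi i / M.pi r := by
              rw [Finset.sum_ite_mem, Finset.univ_inter, Finset.mul_sum]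
          _ ≤ T * (M.cmax * K) * (1 / M.theta) := mul_le_mul_of_nonneg_left h2 hnn
          _ = _ := by ring
  rw [← Finset.sum_compl_add_sum (M.subSet B)]
  have h3 : Real.exp 3 * Real.sqrt N / M.theta ≤ Real.exp 3 * Real.sqrt N * (M.theta ^ 2)⁻¹ := by
    rw [div_eq_mul_inv]
    refine mul_le_mul_of_nonneg_left ?_ (by positivity)
    exact inv_anti₀ (by positivity) (by nlinarith [M.theta_le_one])
  have h4 := mul_le_mul_of_nonneg_left h3 (mul_nonneg (Nat.cast_nonneg (α := ℝ) T) hcm.le)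
  have h5 : T * (M.cmax * K) / M.theta =
      T * M.cmax * ((Real.exp 3 + 1) * Real.sqrt N * (M.theta ^ 2)⁻¹) := by
    rw [hK]
    field_simp
  rw [h5] at hcompl
  have h6 : M.cmax * (T * (Real.exp 3 * Real.sqrt N) / M.theta) =
      T * M.cmax * (Real.exp 3 * Real.sqrt N / M.theta) := by ring
  rw [h6] at hsub
  refine (add_le_add hcompl (hsub.trans h4)).trans_eq ?_
  ring

include hN in
theorem const_le_U (hL : 1 ≤ L) (θ : ℝ) :
    (2 * Real.exp 3 + 1) * (θ ^ 2)⁻¹ ≤ U L θ N := by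
  have hL' : (1 : ℝ) ≤ L := by exact_mod_cast hL
  have hN' : (1 : ℝ) ≤ N := by exact_mod_cast hN
  have he : Real.exp 3 ≤ 27 := by
    rw [show (3 : ℝ) = (3 : ℕ) * 1 by norm_num, Real.exp_nat_mul]
    have h1 := Real.exp_one_lt_d9
    have h2 := pow_le_pow_left₀ (Real.exp_pos 1).le (show Real.exp 1 ≤ 3 by linarith) 3
    linarith
  have hlog : 1 ≤ Real.log (55 * N * L) := by
    rw [Real.le_log_iff_exp_le (by positivity)]
    have h1 := Real.exp_one_lt_d9
    have h2 : (1 : ℝ) ≤ N * L := one_le_mul_of_one_le_of_one_le hN' hL'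
    linarith
  have hL2 : 1 ≤ (L : ℝ) ^ (3 / 2 : ℝ) := Real.one_le_rpow hL' (by norm_num)
  have h3 : 1 ≤ (L : ℝ) ^ (3 / 2 : ℝ) * Real.log (55 * N * L) ^ 2 :=
    one_le_mul_of_one_le_of_one_le hL2 (one_le_pow₀ hlog)
  have h4 : 0 ≤ 1610 * (θ ^ 2)⁻¹ := by positivity
  calc _ ≤ 1610 * (θ ^ 2)⁻¹ := mul_le_mul_of_nonneg_right (by linarith) (by positivity)
    _ ≤ 1610 * (θ ^ 2)⁻¹ * ((L : ℝ) ^ (3 / 2 : ℝ) * Real.log (55 * N * L) ^ 2) :=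
        le_mul_of_one_le_right h4 h3
    _ = _ := by rw [U]; ring

theorem expectedCost_eq_ofReal :
    expectedCost M N lam mu A T =
      ENNReal.ofReal (∑ i, M.cost i * (totalRemaining M N lam mu A T i).toReal) := by
  rw [expectedCost_eq_sum_totalRemaining, ENNReal.ofReal_sum_of_nonneg fun i _ =>
    mul_nonneg (M.cost_pos i).le ENNReal.toReal_nonneg]
  refine Finset.sum_congr rfl fun i _ => ?_
  rw [ENNReal.ofReal_mul (M.cost_pos i).le,
    ENNReal.ofReal_toReal (totalRemaining_ne_top M N lam mu A T i)]

end Main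

end PrioQueue

end

theorem lemma4 {S : Type*} [Fintype S] {L : ℕ} (M : PrioQueue.TreeChain S L)
    (hθ : 0 < M.theta)
    (lam mu : unitInterval) (hlam0 : 0 < (lam : ℝ)) (hlam1 : (lam : ℝ) < 1) (hmu0 : 0 < (mu : ℝ))
    (o : Fin (Fintype.card S) ≃ S) (N : ℕ) (hN : 1 ≤ N)
    (A : PrioQueue.Policy S) (hA : A.IsPrio o) :
    ((PrioQueue.longRunCost M N lam mu A : ENNReal) : EReal) ≤
      (((N : ℝ) * M.fluidCost lam mu o
        + M.cmax * PrioQueue.U L M.theta N * Real.sqrt N : ℝ) : EReal) := by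
  set b : ℝ := (N : ℝ) * M.fluidCost lam mu o + M.cmax * PrioQueue.U L M.theta N * Real.sqrt N
    with hb
  have hL : 1 ≤ L := Nat.one_le_of_lt (M.level M.root).2
  have hcost : ∀ T : ℕ,
      ∑ i, M.cost i * (PrioQueue.totalRemaining M N lam mu A T i).toReal ≤ T * b := by
    intro T
    refine (PrioQueue.sum_cost_mul_totalRemaining_le M hN lam mu T hθ hA).trans ?_
    refine mul_le_mul_of_nonneg_left ?_ (Nat.cast_nonneg T)
    rw [hb, mul_assoc M.cmax]
    exact add_le_add_right (mul_le_mul_of_nonneg_left (mul_le_mul_of_nonneg_right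
      (PrioQueue.const_le_U hN hL M.theta) (Real.sqrt_nonneg N)) (PrioQueue.cmax_pos M).le) _
  have hb0 : 0 ≤ b := by
    have h1 := hcost 1
    rw [Nat.cast_one, one_mul] at h1
    exact (Finset.sum_nonneg fun i _ =>
      mul_nonneg (M.cost_pos i).le ENNReal.toReal_nonneg).trans h1
  have hlim : PrioQueue.longRunCost M N lam mu A ≤ ENNReal.ofReal b := by
    refine Filter.limsup_le_of_le ?_ ?_
    · isBoundedDefault
    · filter_upwards [Filter.eventually_ge_atTop 1] with T hT
      refine ENNReal.div_le_of_le_mul' ?_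
      rw [PrioQueue.expectedCost_eq_ofReal, ← ENNReal.ofReal_natCast,
        ← ENNReal.ofReal_mul (Nat.cast_nonneg T)]
      exact ENNReal.ofReal_le_ofReal (hcost T)
  refine (EReal.coe_ennreal_le_coe_ennreal_iff.2 hlim).trans_eq ?_
  rw [EReal.coe_ennreal_ofReal, max_eq_left hb0]
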